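/- Let $p$ be an odd prime such that the class of $2$ generates the unit group $U(\mathbb Z_{p^2})$, and let $G=\langle a\rangle\times\langle b\rangle$ be an abelian group (internal direct product) with $o(a)=p^2$ and $o(b)=p$. For a subgroup $H\le G$ let $\widehat H=\frac1{|H|}\sum_{h\in H}h\in\mathbb F_2G$, and for $x\in G$ let $\widehat x=\widehat{\langle x\rangle}$. A minimal code is a minimal nonzero ideal of $\mathbb F_2G$; two ideals are $G$-equivalent if the linear extension to $\mathbb F_2 G$ of some automorphism of $G$ maps one onto the other; the weight of a code is the least number of nonzero coefficients of a nonzero element of it. Then: (1) $\mathbb F_2G$ has exactly four $G$-equivalence classes of minimal codes, and the ideals generated by $$e_0=\widehat G,\quad e_1=\widehat b-\widehat{\langle a^p\rangle\times\langle b\rangle},\quad e_2=\widehat a-\widehat G,\quad e_3=\widehat{\langle a^p\rangle\times\langle b\rangle}-\widehat G$$ are minimal codes, pairwise not $G$-equivalent, that represent these four classes. (2) Put $e_{1j}=\widehat{a^{jp}b}-\widehat{\langle a^p\rangle\times\langle b\rangle}$ and $e_{2i}=\widehat{ab^i}-\widehat G$ for $0\le i,j\le p-1$ (so $e_{10}=e_1$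 and $e_{20}=e_2$). The $2p+2$ elements $e_0$, $e_{1j}$, $e_{2i}$, $e_3$ are primitive idempotents, the ideals they generate are pairwise distinct, and these are all the minimal codes of $\mathbb F_2G$. Their dimensions over $\mathbb F_2$ and their weights are: - $\mathbb F_2G\,e_0$: dimension $1$, weight $p^3$; - $\mathbb F_2G\,e_{1j}$ ($0\le j\le p-1$): dimension $p^2-p$, weight $2p$; - $\mathbb F_2G\,e_{2i}$ ($0\le i\le p-1$): dimension $p-1$, weight $2p^2$; - $\mathbb F_2G\,e_3$: dimension $p-1$, weight $2p^2$. (3) $G$ is a finite group of odd order and exponent $p^2$, and $p^2$ has $\tau(p^2)=3\ne4$ divisors. So $G$ is a counterexample to the assertion (Miller's "Theorem A") that for every finite abelian group $G$ of odd order and exponent $n$ there are precisely $\tau(n)$ $G$-equivalence classes of minimal codes in $\mathbb F_2G$, where $\tau(n)$ is the number of divisors of $n$; in particular that assertion is false. -/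

import Mathlib

/-!
Abelian codes: ideals of the group algebra `F G` (Mathlib's `MonoidAlgebra F G`) of an abelian
group `G` over a field `F`.
-/

noncomputable section

namespace AbelianCode

variable {F : Type*} [Field F] {G : Type*} [CommGroup G]

/-- The element `Ĥ = |H|⁻¹ ∑_{h ∈ H} h` of `F G`, for a finite subgroup `H` of `G`. -/
def hat (F : Type*) [Field F] {G : Type*} [CommGroup G] (H : Subgroup G) : MonoidAlgebra F G :=
  (Nat.card H : F)⁻¹ • ∑ᶠ h : H, MonoidAlgebra.single (h : G) (1 : F)

/-- The code `F G · e` generated by `e`. -/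
def code (e : MonoidAlgebra F G) : Ideal (MonoidAlgebra F G) := Ideal.span {e}

/-- A primitive idempotent: a nonzero idempotent that is not the sum of two nonzero
orthogonal idempotents. -/
def IsPrimitiveIdempotent {R : Type*} [CommRing R] (e : R) : Prop :=
  IsIdempotentElem e ∧ e ≠ 0 ∧
    ∀ f g : R, IsIdempotentElem f → IsIdempotentElem g → f * g = 0 → e = f + g → f = 0 ∨ g = 0

/-- A minimal code: a minimal nonzero ideal of `F G`. -/
def IsMinimalCode (I : Ideal (MonoidAlgebra F G)) : Prop := IsAtom I

/-- `G`-equivalence of codes: the linear extension to `F G` of some automorphism of `G` maps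
`I` onto `J`. -/
def GEquivalent (I J : Ideal (MonoidAlgebra F G)) : Prop :=
  ∃ ψ : G ≃* G,
    (MonoidAlgebra.domCongr F F ψ : MonoidAlgebra F G → MonoidAlgebra F G) ''
      (I : Set (MonoidAlgebra F G)) = (J : Set (MonoidAlgebra F G))

theorem GEquivalent.refl (I : Ideal (MonoidAlgebra F G)) : GEquivalent I I := by
  refine ⟨MulEquiv.refl G, ?_⟩
  have h : ∀ x : MonoidAlgebra F G, MonoidAlgebra.domCongr F F (MulEquiv.refl G) x = x := by
    intro x
    ext g
    rw [MonoidAlgebra.coeff_domCongr]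
    rfl
  simp [h]

theorem GEquivalent.symm {I J : Ideal (MonoidAlgebra F G)} (h : GEquivalent I J) :
    GEquivalent J I := by
  obtain ⟨ψ, hψ⟩ := h
  refine ⟨ψ.symm, ?_⟩
  rw [← hψ, Set.image_image]
  have h : ∀ x : MonoidAlgebra F G,
      MonoidAlgebra.domCongr F F ψ.symm (MonoidAlgebra.domCongr F F ψ x) = x := by
    intro x
    ext g
    rw [MonoidAlgebra.coeff_domCongr, MonoidAlgebra.coeff_domCongr]
    simp
  simp [h]

theorem GEquivalent.trans {I J K : Ideal (MonoidAlgebra F G)} (h : GEquivalent I J)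
    (h' : GEquivalent J K) : GEquivalent I K := by
  obtain ⟨ψ, hψ⟩ := h
  obtain ⟨φ, hφ⟩ := h'
  refine ⟨ψ.trans φ, ?_⟩
  rw [← hφ, ← hψ, Set.image_image]
  have h : ∀ x : MonoidAlgebra F G,
      MonoidAlgebra.domCongr F F (ψ.trans φ) x =
        MonoidAlgebra.domCongr F F φ (MonoidAlgebra.domCongr F F ψ x) := by
    intro x
    ext g
    rw [MonoidAlgebra.coeff_domCongr, MonoidAlgebra.coeff_domCongr, MonoidAlgebra.coeff_domCongr]
    rfl
  simp [h]

/-- `G`-equivalence as an equivalence relation on the minimal codes of `F G`. -/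
def minimalCodeSetoid (F : Type*) [Field F] (G : Type*) [CommGroup G] :
    Setoid {I : Ideal (MonoidAlgebra F G) // IsMinimalCode I} where
  r I J := GEquivalent I.1 J.1
  iseqv := ⟨fun I => GEquivalent.refl I.1, fun h => h.symm, fun h h' => h.trans h'⟩

/-- The number of `G`-equivalence classes of minimal codes of `F G`. -/
def numMinimalClasses (F : Type*) [Field F] (G : Type*) [CommGroup G] : ℕ :=
  Nat.card (Quotient (minimalCodeSetoid F G))

/-- The dimension over `F` of a code. -/
def dim (I : Ideal (MonoidAlgebra F G)) : ℕ := Module.finrank F (I.restrictScalars F)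

/-- The Hamming weight of an element of `F G`: the number of its nonzero coefficients. -/
def elemWeight (x : MonoidAlgebra F G) : ℕ := x.coeff.support.card

/-- The weight of a (nonzero) code: the least weight of a nonzero element. -/
def weight (I : Ideal (MonoidAlgebra F G)) : ℕ :=
  sInf {n | ∃ x ∈ I, x ≠ 0 ∧ elemWeight x = n}

/-- The assertion claimed by Miller for a finite abelian group `G`: if `G` has odd order and
exponent `n`, then `𝔽₂ G` has precisely `τ(n)` classes of `G`-equivalent minimal codes, where
`τ(n)` is the number of divisors of `n`. -/
def MillerClaim (G : Type*) [CommGroup G] : Prop :=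
  Odd (Nat.card G) → numMinimalClasses (ZMod 2) G = (Monoid.exponent G).divisors.card

section Rows

variable (p : ℕ) (a b : G)

/-- `Ĝ`. -/
def e₀ (G : Type*) [CommGroup G] : MonoidAlgebra (ZMod 2) G := hat (ZMod 2) (⊤ : Subgroup G)

/-- The element `(a^{jp} b)^ - (⟨a^p⟩ × ⟨b⟩)^`; for `j = 0` it is `b̂ - (⟨a^p⟩ × ⟨b⟩)^`. -/
def e₁ (j : ℕ) : MonoidAlgebra (ZMod 2) G :=
  hat (ZMod 2) (Subgroup.zpowers (a ^ (j * p) * b)) -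
    hat (ZMod 2) (Subgroup.zpowers (a ^ p) ⊔ Subgroup.zpowers b)

/-- The element `(a b^i)^ - Ĝ`; for `i = 0` it is `â - Ĝ`. -/
def e₂ (i : ℕ) : MonoidAlgebra (ZMod 2) G :=
  hat (ZMod 2) (Subgroup.zpowers (a * b ^ i)) - hat (ZMod 2) (⊤ : Subgroup G)

/-- The element `(⟨a^p⟩ × ⟨b⟩)^ - Ĝ`. -/
def e₃ : MonoidAlgebra (ZMod 2) G :=
  hat (ZMod 2) (Subgroup.zpowers (a ^ p) ⊔ Subgroup.zpowers b) -
    hat (ZMod 2) (⊤ : Subgroup G)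

/-- The four representatives
`Ĝ`, `b̂ - (⟨a^p⟩ × ⟨b⟩)^`, `â - Ĝ`, `(⟨a^p⟩ × ⟨b⟩)^ - Ĝ`. -/
def rep : Fin 4 → MonoidAlgebra (ZMod 2) G :=
  ![hat (ZMod 2) (⊤ : Subgroup G),
    hat (ZMod 2) (Subgroup.zpowers b) -
      hat (ZMod 2) (Subgroup.zpowers (a ^ p) ⊔ Subgroup.zpowers b),
    hat (ZMod 2) (Subgroup.zpowers a) - hat (ZMod 2) (⊤ : Subgroup G),
    hat (ZMod 2) (Subgroup.zpowers (a ^ p) ⊔ Subgroup.zpowers b) -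
      hat (ZMod 2) (⊤ : Subgroup G)]

end Rows

end AbelianCode

end

/-!
In the semisimple algebra `𝔽₂ G` every idempotent is fixed by the Frobenius `f ↦ f ^ 2`, so its
coefficients are constant along `g ↦ g ^ 2`. As `2` generates the units modulo the exponent of `G`,
they are constant on the generators of each cyclic subgroup, and the idempotents span a space of
dimension at most the number of cyclic subgroups. The subgroups `1`, `⟨a ^ p⟩`, `⟨a ^ (j * p) * b⟩`
and `⟨a * b ^ i⟩` are all the cyclic ones, and equally many nonzero orthogonal idempotents
`Ĥ - K̂` are at hand; hence these are primitive and generate all the minimal codes.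

The elements of the code of `Ĥ - K̂` are constant on the cosets of `H` and have coefficient sum
zero on each coset of `K`, which gives its dimension `[G : H] - [G : K]` and its weight `2 * |H|`.
Since `a * b ^ i` and `a ^ (j * p) * b` form again a basis of `G`, automorphisms identify the codes
of all the `e₁ j`, and those of all the `e₂ i`. Weights separate the four classes except those of
`e₂` and `e₃`, which differ because no automorphism maps the cyclic group `⟨a⟩` onto the
noncyclic group `⟨a ^ p⟩ × ⟨b⟩`.
-/

noncomputable section

namespace AbelianCode

open MonoidAlgebra Subgroup

section Hat

variable {F : Type*} [Field F] {G : Type*} [CommGroup G]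

open Classical in
theorem coeff_hat (H : Subgroup G) [Finite H] (g : G) :
    (hat F H).coeff g = if g ∈ H then (Nat.card H : F)⁻¹ else 0 := by
  have := Fintype.ofFinite H
  simp only [hat, finsum_eq_sum_of_fintype, coeff_smul, coeff_sum, Finsupp.smul_apply,
    Finsupp.finsetSum_apply, coeff_single, Finsupp.single_apply, smul_eq_mul]
  split_ifs with hg
  · rw [Fintype.sum_eq_single ⟨g, hg⟩ fun h hne => if_neg fun hh => hne (Subtype.ext hh),
      if_pos rfl, mul_one]
  · have hne (h : H) : (h : G) ≠ g := fun hh => hg (hh ▸ h.2)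
    simp only [hne, if_false, Finset.sum_const_zero, mul_zero]

theorem single_mul_hat {H : Subgroup G} [Finite H] {h : G} (hh : h ∈ H) :
    single h 1 * hat F H = hat F H := by
  classical
  ext g
  rw [coeff_single_mul_apply, coeff_hat, coeff_hat, one_mul,
    H.mul_mem_cancel_left (H.inv_mem hh)]

theorem domCongr_hat (ψ : G ≃* G) (H : Subgroup G) [Finite H] :
    domCongr F F ψ (hat F H) = hat F (H.map ψ.toMonoidHom) := by
  classical
  have hcard := Nat.card_congr (H.equivMapOfInjective ψ.toMonoidHom ψ.injective).toEquiv
  have : Finite (H.map ψ.toMonoidHom) := Set.Finite.image _ (Set.toFinite (H : Set G))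
  ext g
  rw [coeff_domCongr, coeff_hat, coeff_hat, ← hcard]
  exact if_congr Subgroup.mem_map_equiv.symm rfl rfl

theorem natCast_card_subgroup_ne_zero (F : Type*) [Field F] [NeZero (Nat.card G : F)]
    (H : Subgroup G) : (Nat.card H : F) ≠ 0 := fun h =>
  NeZero.ne (Nat.card G : F) <| by
    rw [← H.card_mul_index, Nat.cast_mul, h, zero_mul]

theorem finite_of_natCast_card_ne_zero (F : Type*) [Field F] (G : Type*)
    [NeZero (Nat.card G : F)] : Finite G :=
  Nat.finite_of_card_ne_zero fun h => NeZero.ne (Nat.card G : F) <| by rw [h, Nat.cast_zero]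

variable [NeZero (Nat.card G : F)]

theorem hat_mul_eq_self_iff {H : Subgroup G} {x : MonoidAlgebra F G} :
    hat F H * x = x ↔ ∀ h ∈ H, single h 1 * x = x := by
  have := finite_of_natCast_card_ne_zero F G
  constructor
  · intro hx h hh
    rw [← hx, ← mul_assoc, single_mul_hat hh]
  · intro hx
    have := Fintype.ofFinite H
    rw [hat, finsum_eq_sum_of_fintype, smul_mul_assoc, Finset.sum_mul,
      Finset.sum_congr rfl fun (h : H) _ => hx h h.2, Finset.sum_const, Finset.card_univ,
      ← Nat.card_eq_fintype_card, ← Nat.cast_smul_eq_nsmul F,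
      inv_smul_smul₀ (natCast_card_subgroup_ne_zero F H)]

theorem hat_mul_hat_of_le {H K : Subgroup G} (hHK : H ≤ K) : hat F H * hat F K = hat F K :=
  have := finite_of_natCast_card_ne_zero F G
  hat_mul_eq_self_iff.2 fun _ hh => single_mul_hat (hHK hh)

theorem isIdempotentElem_hat (H : Subgroup G) : IsIdempotentElem (hat F H) :=
  hat_mul_hat_of_le le_rfl

theorem hat_mul_hat (H K : Subgroup G) : hat F H * hat F K = hat F (H ⊔ K) := by
  have := finite_of_natCast_card_ne_zero F G
  have hsup : hat F (H ⊔ K) * (hat F H * hat F K) = hat F H * hat F K := by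
    refine hat_mul_eq_self_iff.2 fun g hg => ?_
    obtain ⟨h, hh, k, hk, rfl⟩ := Subgroup.mem_sup.1 hg
    rw [← one_mul (1 : F), ← single_mul_single, mul_mul_mul_comm, single_mul_hat hh,
      single_mul_hat hk]
  rw [← hsup, mul_comm, mul_assoc, hat_mul_hat_of_le le_sup_right,
    hat_mul_hat_of_le le_sup_left]

theorem coeff_hat_ne_zero_iff {H : Subgroup G} {g : G} : (hat F H).coeff g ≠ 0 ↔ g ∈ H := by
  classical
  have := finite_of_natCast_card_ne_zero F G
  rw [coeff_hat, Ne, ite_eq_right_iff, Classical.not_imp, inv_eq_zero]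
  exact and_iff_left (natCast_card_subgroup_ne_zero F H)

theorem hat_injective : Function.Injective (hat F : Subgroup G → MonoidAlgebra F G) :=
  fun H K hHK => Subgroup.ext fun g => by
    rw [← coeff_hat_ne_zero_iff (F := F), hHK, coeff_hat_ne_zero_iff]

theorem hat_ne_zero (H : Subgroup G) : hat F H ≠ 0 := fun h =>
  coeff_hat_ne_zero_iff.2 H.one_mem <| by rw [h, coeff_zero, Finsupp.zero_apply]

theorem isIdempotentElem_hat_sub_hat {H K : Subgroup G} (hHK : H ≤ K) :
    IsIdempotentElem (hat F H - hat F K) := by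
  rw [IsIdempotentElem, sub_mul, mul_sub, mul_sub, isIdempotentElem_hat, isIdempotentElem_hat,
    hat_mul_hat_of_le hHK, mul_comm, hat_mul_hat_of_le hHK, sub_self, sub_zero]

theorem hat_mul_hat_sub_hat {H K : Subgroup G} (hHK : H ≤ K) :
    hat F H * (hat F H - hat F K) = hat F H - hat F K := by
  rw [mul_sub, isIdempotentElem_hat, hat_mul_hat_of_le hHK]

theorem hat_sub_hat_mul_hat_eq_zero {H K L : Subgroup G} (hHK : H ≤ K) (hKL : K ≤ H ⊔ L) :
    (hat F H - hat F K) * hat F L = 0 := by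
  rw [sub_mul, hat_mul_hat, hat_mul_hat, sub_eq_zero,
    le_antisymm (sup_le hKL le_sup_right) (sup_le_sup_right hHK L)]

theorem hat_sub_hat_mul_hat_sub_hat_eq_zero {H K L M : Subgroup G} (hHK : H ≤ K)
    (hKL : K ≤ H ⊔ L) (hLM : L ≤ M) : (hat F H - hat F K) * (hat F L - hat F M) = 0 := by
  rw [mul_sub, hat_sub_hat_mul_hat_eq_zero hHK hKL,
    hat_sub_hat_mul_hat_eq_zero hHK (hKL.trans (sup_le_sup_left hLM H)), sub_zero]

end Hat

section SpanIdempotent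

variable {R : Type*} [CommRing R] {e f x : R}

theorem mem_span_singleton_iff_of_isIdempotentElem (he : IsIdempotentElem e) :
    x ∈ Ideal.span {e} ↔ e * x = x := by
  rw [Ideal.mem_span_singleton']
  constructor
  · rintro ⟨y, rfl⟩
    rw [mul_left_comm, he]
  · exact fun hx => ⟨x, by rw [mul_comm, hx]⟩

theorem eq_of_span_singleton_eq_of_isIdempotentElem (he : IsIdempotentElem e)
    (hf : IsIdempotentElem f) (hef : Ideal.span {e} = Ideal.span {f}) : e = f := by
  have h_ef : e * f = f := (mem_span_singleton_iff_of_isIdempotentElem he).1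
    (hef ▸ Ideal.mem_span_singleton_self f)
  have h_fe : f * e = e := (mem_span_singleton_iff_of_isIdempotentElem hf).1
    (hef ▸ Ideal.mem_span_singleton_self e)
  rw [← h_fe, mul_comm, h_ef]

theorem span_add_eq_sup_of_mul_eq_zero (he : IsIdempotentElem e) (hf : IsIdempotentElem f)
    (hef : e * f = 0) : Ideal.span {e + f} = Ideal.span {e} ⊔ Ideal.span {f} := by
  refine le_antisymm ?_ (sup_le ?_ ?_)
  · rw [Ideal.span_singleton_le_iff_mem]
    exact Submodule.add_mem_sup (Ideal.mem_span_singleton_self e) (Ideal.mem_span_singleton_self f)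
  · rw [Ideal.span_singleton_le_iff_mem, Ideal.mem_span_singleton']
    exact ⟨e, by rw [mul_add, he, hef, add_zero]⟩
  · rw [Ideal.span_singleton_le_iff_mem, Ideal.mem_span_singleton']
    exact ⟨f, by rw [mul_add, hf, mul_comm, hef, zero_add]⟩

theorem disjoint_span_of_mul_eq_zero (he : IsIdempotentElem e) (hf : IsIdempotentElem f)
    (hef : e * f = 0) : Disjoint (Ideal.span {e}) (Ideal.span {f}) := by
  rw [Submodule.disjoint_def]
  intro x hxe hxf
  rw [mem_span_singleton_iff_of_isIdempotentElem he] at hxe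
  rw [mem_span_singleton_iff_of_isIdempotentElem hf] at hxf
  rw [← hxe, ← hxf, ← mul_assoc, hef, zero_mul]

end SpanIdempotent

section Code

variable {F : Type*} [Field F] {G : Type*} [CommGroup G]

theorem elemWeight_single_mul (g : G) (x : MonoidAlgebra F G) :
    elemWeight (single g 1 * x) = elemWeight x := by
  rw [elemWeight, support_coeff_single_mul _ _ (by simp), Finset.card_map, elemWeight]

theorem elemWeight_sub_le (x y : MonoidAlgebra F G) :
    elemWeight (x - y) ≤ elemWeight x + elemWeight y := by
  classical
  rw [elemWeight, coeff_sub]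
  exact (Finset.card_le_card Finsupp.support_sub).trans (Finset.card_union_le _ _)

theorem weight_eq_of_forall_le {I : Ideal (MonoidAlgebra F G)} {n : ℕ}
    (hle : ∀ x ∈ I, x ≠ 0 → n ≤ elemWeight x) (hex : ∃ x ∈ I, x ≠ 0 ∧ elemWeight x ≤ n) :
    weight I = n := by
  obtain ⟨x, hxI, hx0, hxn⟩ := hex
  have hx : elemWeight x ∈ {n | ∃ x ∈ I, x ≠ 0 ∧ elemWeight x = n} := ⟨x, hxI, hx0, rfl⟩
  refine le_antisymm ((Nat.sInf_le hx).trans hxn) (le_csInf ⟨_, hx⟩ ?_)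
  rintro m ⟨y, hyI, hy0, rfl⟩
  exact hle y hyI hy0

theorem dim_code_add [Finite G] {e f : MonoidAlgebra F G} (he : IsIdempotentElem e)
    (hf : IsIdempotentElem f) (hef : e * f = 0) :
    dim (code (e + f)) = dim (code e) + dim (code f) := by
  have : Module.Finite F (MonoidAlgebra F G) := .of_basis (MonoidAlgebra.basis G F)
  have hinf : code e ⊓ code f = ⊥ := (disjoint_span_of_mul_eq_zero he hf hef).eq_bot
  have hsup : code (e + f) = code e ⊔ code f := span_add_eq_sup_of_mul_eq_zero he hf hef
  rw [dim, dim, dim, ← Submodule.finrank_sup_add_finrank_inf_eq, ← Submodule.restrictScalars_inf,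
    ← Submodule.restrictScalars_sup, hinf, Submodule.restrictScalars_bot, finrank_bot, add_zero,
    hsup]

variable [NeZero (Nat.card G : F)]

theorem mem_code_hat_iff {H : Subgroup G} {x : MonoidAlgebra F G} :
    x ∈ code (hat F H) ↔ ∀ h ∈ H, ∀ g, x.coeff (g * h) = x.coeff g := by
  rw [code, mem_span_singleton_iff_of_isIdempotentElem (isIdempotentElem_hat H),
    hat_mul_eq_self_iff]
  constructor
  · intro hx h hh g
    calc x.coeff (g * h) = (single h⁻¹ 1 * x).coeff g := by
          rw [coeff_single_mul_apply, one_mul, inv_inv, mul_comm]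
      _ = x.coeff g := by rw [hx _ (H.inv_mem hh)]
  · intro hx h hh
    ext g
    rw [coeff_single_mul_apply, one_mul, mul_comm, hx _ (H.inv_mem hh)]

theorem dim_code_hat (H : Subgroup G) : dim (code (hat F H)) = H.index := by
  have := finite_of_natCast_card_ne_zero F G
  have := Fintype.ofFinite (G ⧸ H)
  let pullback : (G ⧸ H → F) →ₗ[F] MonoidAlgebra F G :=
    (coeffLinearEquiv F).symm.toLinearMap ∘ₗ
      (Finsupp.linearEquivFunOnFinite F F G).symm.toLinearMap ∘ₗ
        LinearMap.funLeft F F (QuotientGroup.mk : G → G ⧸ H)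
  have coeff_pullback (φ g) : (pullback φ).coeff g = φ (QuotientGroup.mk g) := rfl
  have pullback_injective : Function.Injective pullback := fun φ ψ h => by
    ext ⟨g⟩
    exact (coeff_pullback φ g).symm.trans (h ▸ coeff_pullback ψ g)
  have range_pullback : LinearMap.range pullback = (code (hat F H)).restrictScalars F := by
    ext x
    rw [Submodule.restrictScalars_mem, mem_code_hat_iff]
    constructor
    · rintro ⟨φ, rfl⟩ h hh g
      rw [coeff_pullback, coeff_pullback, QuotientGroup.mk_mul_of_mem g hh]
    · refine fun hx => ⟨fun q => Quotient.liftOn' q x.coeff fun g g' hgg' => ?_, by ext; rfl⟩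
      rw [QuotientGroup.leftRel_apply] at hgg'
      rw [← hx _ hgg' g, mul_inv_cancel_left]
  rw [dim, ← range_pullback, LinearMap.finrank_range_of_inj pullback_injective,
    Module.finrank_fintype_fun_eq_card, ← Nat.card_eq_fintype_card, Subgroup.index]

theorem dim_code_hat_sub_hat {H K : Subgroup G} (hHK : H ≤ K) :
    dim (code (hat F H - hat F K)) = H.index - K.index := by
  have := finite_of_natCast_card_ne_zero F G
  have hadd := dim_code_add (isIdempotentElem_hat_sub_hat (F := F) hHK) (isIdempotentElem_hat K)
    (hat_sub_hat_mul_hat_eq_zero hHK le_sup_right)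
  rw [sub_add_cancel, dim_code_hat, dim_code_hat] at hadd
  exact Nat.eq_sub_of_add_eq hadd.symm

theorem mem_code_hat_sub_hat_iff {H K : Subgroup G} (hHK : H ≤ K) {x : MonoidAlgebra F G} :
    x ∈ code (hat F H - hat F K) ↔ x ∈ code (hat F H) ∧ hat F K * x = 0 := by
  rw [code, code, mem_span_singleton_iff_of_isIdempotentElem (isIdempotentElem_hat_sub_hat hHK),
    mem_span_singleton_iff_of_isIdempotentElem (isIdempotentElem_hat H)]
  constructor
  · intro hx
    refine ⟨?_, ?_⟩
    · rw [← hx, ← mul_assoc, hat_mul_hat_sub_hat hHK]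
    · rw [← hx, ← mul_assoc, mul_comm (hat F K),
        hat_sub_hat_mul_hat_eq_zero hHK le_sup_right, zero_mul]
  · rintro ⟨hH, hK⟩
    rw [sub_mul, hH, hK, sub_zero]

open scoped Pointwise in
theorem elemWeight_of_mem_code_hat {H : Subgroup G} {x : MonoidAlgebra F G}
    (hx : x ∈ code (hat F H)) :
    elemWeight x =
      Nat.card H * ((QuotientGroup.mk : G → G ⧸ H) '' (x.coeff.support : Set G)).ncard := by
  have hsupp : (x.coeff.support : Set G) * (H : Set G) = x.coeff.support := by
    refine (Set.mul_subset_iff.2 fun g hg h hh => ?_).antisymm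
      fun g hg => ⟨g, hg, 1, H.one_mem, mul_one g⟩
    rw [Finset.mem_coe, Finsupp.mem_support_iff] at hg ⊢
    rwa [mem_code_hat_iff.1 hx h hh]
  rw [← Nat.card_coe_set_eq, ← Subgroup.card_mul_eq_card_subgroup_mul_card_quotient, hsupp,
    Nat.card_coe_set_eq, Set.ncard_coe_finset, elemWeight]

theorem elemWeight_hat (H : Subgroup G) : elemWeight (hat F H) = Nat.card H := by
  have hsupp : ((hat F H).coeff.support : Set G) = H :=
    Set.ext fun g => Finsupp.mem_support_iff.trans coeff_hat_ne_zero_iff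
  rw [elemWeight, ← Set.ncard_coe_finset, hsupp, ← Nat.card_coe_set_eq]
  rfl

theorem weight_code_hat (H : Subgroup G) : weight (code (hat F H)) = Nat.card H := by
  refine weight_eq_of_forall_le (fun x hx hx0 => ?_)
    ⟨hat F H, Ideal.mem_span_singleton_self _, hat_ne_zero H, (elemWeight_hat H).le⟩
  have := finite_of_natCast_card_ne_zero F G
  rw [elemWeight_of_mem_code_hat hx]
  have hsupp : x.coeff.support.Nonempty := Finsupp.support_nonempty_iff.2 (coeff_eq_zero.not.2 hx0)
  exact Nat.le_mul_of_pos_right _ <|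
    (Set.ncard_pos (Set.toFinite _)).2 ((Finset.coe_nonempty.2 hsupp).image _)

theorem eq_smul_single_mul_hat {H : Subgroup G} {x : MonoidAlgebra F G}
    (hx : x ∈ code (hat F H)) {g : G} (hg : ∀ k, x.coeff k ≠ 0 → g⁻¹ * k ∈ H) :
    x = ((Nat.card H : F) * x.coeff g) • (single g 1 * hat F H) := by
  classical
  have := finite_of_natCast_card_ne_zero F G
  ext k
  rw [coeff_smul, Finsupp.smul_apply, coeff_single_mul_apply, coeff_hat, smul_eq_mul, one_mul]
  split_ifs with hk
  · rw [mul_right_comm, mul_inv_cancel₀ (natCast_card_subgroup_ne_zero F H), one_mul,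
      ← mem_code_hat_iff.1 hx _ hk g, mul_inv_cancel_left]
  · rw [mul_zero]
    exact not_imp_comm.1 (hg k) hk

theorem two_mul_card_le_elemWeight {H K : Subgroup G} (hHK : H ≤ K) {x : MonoidAlgebra F G}
    (hx : x ∈ code (hat F H - hat F K)) (hx0 : x ≠ 0) : 2 * Nat.card H ≤ elemWeight x := by
  have := finite_of_natCast_card_ne_zero F G
  obtain ⟨hxH, hKx⟩ := (mem_code_hat_sub_hat_iff hHK).1 hx
  rw [elemWeight_of_mem_code_hat hxH, mul_comm]
  refine Nat.mul_le_mul_left _ (Set.one_lt_ncard_iff_nontrivial.2 ?_)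
  by_contra hcoset
  rw [Set.not_nontrivial_iff] at hcoset
  obtain ⟨g, hg⟩ : x.coeff.support.Nonempty :=
    Finsupp.support_nonempty_iff.2 (coeff_eq_zero.not.2 hx0)
  have hxg := eq_smul_single_mul_hat hxH (g := g) fun k hk => QuotientGroup.eq.1 <|
    hcoset ⟨g, hg, rfl⟩ ⟨k, Finsupp.mem_support_iff.2 hk, rfl⟩
  rw [hxg, mul_smul_comm, mul_left_comm, mul_comm (hat F K), hat_mul_hat_of_le hHK,
    smul_eq_zero_iff_right (mul_ne_zero (natCast_card_subgroup_ne_zero F H)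
      (Finsupp.mem_support_iff.1 hg))] at hKx
  refine hat_ne_zero (F := F) K ?_
  rw [← one_mul (hat F K), one_def, ← inv_mul_cancel g, ← one_mul (1 : F), ← single_mul_single,
    mul_assoc, hKx, mul_zero]

theorem weight_code_hat_sub_hat {H K : Subgroup G} (hHK : H < K) :
    weight (code (hat F H - hat F K)) = 2 * Nat.card H := by
  have := finite_of_natCast_card_ne_zero F G
  obtain ⟨k, hkK, hkH⟩ := SetLike.exists_of_lt hHK
  refine weight_eq_of_forall_le (fun x hx hx0 => two_mul_card_le_elemWeight hHK.le hx hx0)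
    ⟨hat F H - single k 1 * hat F H, ?_, fun h0 => hkH ?_, ?_⟩
  · rw [mem_code_hat_sub_hat_iff hHK.le, code,
      mem_span_singleton_iff_of_isIdempotentElem (isIdempotentElem_hat H)]
    constructor
    · rw [mul_sub, mul_left_comm, isIdempotentElem_hat]
    · rw [mul_sub, mul_left_comm, mul_comm (hat F K), hat_mul_hat_of_le hHK.le,
        single_mul_hat hkK, sub_self]
  · refine coeff_hat_ne_zero_iff (F := F).1 ?_
    rw [sub_eq_zero.1 h0, coeff_single_mul_apply, inv_mul_cancel, one_mul]
    exact coeff_hat_ne_zero_iff.2 H.one_mem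
  · calc elemWeight (hat F H - single k 1 * hat F H)
        ≤ elemWeight (hat F H) + elemWeight (single k 1 * hat F H) := elemWeight_sub_le _ _
      _ = 2 * Nat.card H := by rw [elemWeight_single_mul, elemWeight_hat, two_mul]

end Code

section PrimitiveIdempotents

theorem le_span_range_of_injOn {F M ι : Type*} [Field F] [AddCommGroup M] [Module F M]
    [Finite ι] {E : ι → M} (hE : LinearIndependent F E) {V : Submodule F M}
    (hEV : ∀ k, E k ∈ V) (φ : M →ₗ[F] ι → F) (hφ : Set.InjOn φ V) :
    V ≤ Submodule.span F (Set.range E) := by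
  have := Fintype.ofFinite ι
  have hinj : Function.Injective (φ.domRestrict V) := fun x y hxy =>
    Subtype.ext (hφ x.2 y.2 hxy)
  have : Module.Finite F V := .of_injective _ hinj
  have hle : Submodule.span F (Set.range E) ≤ V :=
    Submodule.span_le.2 (Set.range_subset_iff.2 hEV)
  refine (Submodule.eq_of_le_of_finrank_le hle ?_).ge
  rw [finrank_span_eq_card hE, ← Module.finrank_fintype_fun_eq_card F]
  exact LinearMap.finrank_le_finrank_of_injective hinj

variable {R : Type*} [CommRing R]

theorem IsPrimitiveIdempotent.mul_eq_zero_or_eq {e f : R} (he : IsPrimitiveIdempotent e)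
    (hf : IsIdempotentElem f) : e * f = 0 ∨ e * f = e := by
  refine (he.2.2 (e * f) (e * (1 - f)) (he.1.mul hf) (he.1.mul hf.one_sub) ?_ ?_).imp_right
    fun h => ?_
  · rw [mul_mul_mul_comm, mul_one_sub, hf, sub_self, mul_zero]
  · rw [← mul_add, add_sub_cancel, mul_one]
  · rwa [mul_one_sub, sub_eq_zero, eq_comm] at h

theorem IsPrimitiveIdempotent.isAtom_span [IsSemisimpleRing R] {e : R}
    (he : IsPrimitiveIdempotent e) : IsAtom (Ideal.span {e}) := by
  refine ⟨mt Ideal.span_singleton_eq_bot.1 he.2.1, fun J hJ => ?_⟩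
  obtain ⟨f, hf, rfl⟩ := IsSemisimpleRing.ideal_eq_span_idempotent J
  have hef : e * f = f := (mem_span_singleton_iff_of_isIdempotentElem he.1).1
    (hJ.le (Ideal.mem_span_singleton_self f))
  rcases he.mul_eq_zero_or_eq hf with h | h
  · rw [← hef, h, Ideal.span_singleton_eq_bot]
  · exact absurd (by rw [← hef, h]) hJ.ne

variable {ι : Type*} {E : ι → R}

theorem isAtom_iff_exists_eq_span [IsSemisimpleRing R] [Fintype ι]
    (hE : CompleteOrthogonalIdempotents E) (hprim : ∀ k, IsPrimitiveIdempotent (E k))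
    {I : Ideal R} : IsAtom I ↔ ∃ k, I = Ideal.span {E k} := by
  refine ⟨fun hI => ?_, fun ⟨k, hk⟩ => hk ▸ (hprim k).isAtom_span⟩
  obtain ⟨f, hf, rfl⟩ := IsSemisimpleRing.ideal_eq_span_idempotent I
  have hf0 : f ≠ 0 := mt Ideal.span_singleton_eq_bot.2 hI.1
  obtain ⟨k, hk⟩ : ∃ k, E k * f ≠ 0 := by
    by_contra! h
    refine hf0 ?_
    rw [← one_mul f, ← hE.complete, Finset.sum_mul, Finset.sum_eq_zero fun k _ => h k]
  have hle : Ideal.span {E k} ≤ Ideal.span {f} := by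
    rw [Ideal.span_singleton_le_iff_mem, mem_span_singleton_iff_of_isIdempotentElem hf, mul_comm]
    exact ((hprim k).mul_eq_zero_or_eq hf).resolve_left hk
  exact ⟨k, ((hI.le_iff.1 hle).resolve_left (hprim k).isAtom_span.1).symm⟩

theorem span_singleton_injective_of_orthogonalIdempotents (hE : OrthogonalIdempotents E)
    (hne : ∀ k, E k ≠ 0) : Function.Injective fun k => Ideal.span {E k} := by
  intro k l h
  by_contra hkl
  have hEkl := eq_of_span_singleton_eq_of_isIdempotentElem (hE.idem k) (hE.idem l) h
  refine hne k ?_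
  rw [← hE.idem k]
  nth_rw 2 [hEkl]
  exact hE.ortho hkl

theorem orthogonalIdempotents_sumElim {κ : Type*} {E' : κ → R} (hE : OrthogonalIdempotents E)
    (hE' : OrthogonalIdempotents E') (hEE' : ∀ i j, E i * E' j = 0) :
    OrthogonalIdempotents (Sum.elim E E') where
  idem := by
    rintro (i | j)
    exacts [hE.idem i, hE'.idem j]
  ortho := by
    rintro (i | i) (j | j) hij
    · exact hE.ortho (ne_of_apply_ne Sum.inl hij)
    · exact hEE' i j
    · exact (mul_comm _ _).trans (hEE' j i)
    · exact hE'.ortho (ne_of_apply_ne Sum.inr hij)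

variable {F : Type*} [Field F] [Algebra F R]

theorem linearIndependent_of_orthogonalIdempotents (hE : OrthogonalIdempotents E)
    (hne : ∀ k, E k ≠ 0) : LinearIndependent F E := by
  refine linearIndependent_iff'.2 fun s c hc k hk => ?_
  have hck : (∑ i ∈ s, c i • E i) * E k = c k • E k := by
    rw [Finset.sum_mul, Finset.sum_eq_single_of_mem k hk fun i _ hik => by
      rw [smul_mul_assoc, hE.ortho hik, smul_zero], smul_mul_assoc, hE.idem k]
  rw [hc, zero_mul] at hck
  exact (smul_eq_zero.1 hck.symm).resolve_right (hne k)

theorem exists_mul_eq_smul_of_mem_span (hE : OrthogonalIdempotents E) {x : R}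
    (hx : x ∈ Submodule.span F (Set.range E)) (k : ι) : ∃ c : F, E k * x = c • E k := by
  classical
  induction hx using Submodule.span_induction with
  | mem x hx =>
    obtain ⟨i, rfl⟩ := hx
    refine ⟨if k = i then 1 else 0, ?_⟩
    rw [hE.mul_eq, ite_smul, one_smul, zero_smul]
  | zero => exact ⟨0, by rw [mul_zero, zero_smul]⟩
  | add x y _ _ hx hy =>
    obtain ⟨⟨c, hc⟩, d, hd⟩ := And.intro hx hy
    exact ⟨c + d, by rw [mul_add, hc, hd, add_smul]⟩
  | smul a x _ hx =>
    obtain ⟨c, hc⟩ := hx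
    exact ⟨a * c, by rw [mul_smul_comm, hc, mul_smul]⟩

theorem isPrimitiveIdempotent_of_forall_mem_span (hE : OrthogonalIdempotents E)
    (hspan : ∀ f : R, IsIdempotentElem f → f ∈ Submodule.span F (Set.range E)) {k : ι}
    (hk : E k ≠ 0) : IsPrimitiveIdempotent (E k) := by
  refine ⟨hE.idem k, hk, fun f g hf hg hfg hsum => ?_⟩
  obtain ⟨c, hc⟩ := exists_mul_eq_smul_of_mem_span hE (hspan f hf) k
  have hfc : f = c • E k := by
    rw [← hc, hsum, add_mul, hf, mul_comm g, hfg, add_zero]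
  have hEg : E k * g = g := by rw [hsum, add_mul, hfg, hg, zero_add]
  have hcg : c • g = 0 := by rw [← hEg, ← smul_mul_assoc, ← hfc, hfg]
  refine (smul_eq_zero.1 hcg).imp_left fun hc0 => ?_
  rw [hfc, hc0, zero_smul]

theorem completeOrthogonalIdempotents_of_one_mem_span [Fintype ι] (hE : OrthogonalIdempotents E)
    (hone : (1 : R) ∈ Submodule.span F (Set.range E)) : CompleteOrthogonalIdempotents E := by
  refine ⟨hE, ?_⟩
  have hmul {x : R} (hx : x ∈ Submodule.span F (Set.range E)) : x * ∑ k, E k = x := by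
    induction hx using Submodule.span_induction with
    | mem x hx =>
      obtain ⟨k, rfl⟩ := hx
      exact hE.mul_sum_of_mem (Finset.mem_univ k)
    | zero => rw [zero_mul]
    | add x y _ _ hx hy => rw [add_mul, hx, hy]
    | smul a x _ hx => rw [smul_mul_assoc, hx]
  rw [← one_mul (∑ k, E k), hmul hone]

end PrimitiveIdempotents

section Frobenius

variable {F : Type*} [Field F] [Fintype F] {G : Type*} [CommGroup G]

theorem coprime_card_of_natCast_ne_zero {n : ℕ} (hn : (n : F) ≠ 0) :
    n.Coprime (Fintype.card F) := by
  obtain ⟨p, hchar, m, hp, hcard⟩ := FiniteField.card' F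
  rw [hcard]
  exact (((Nat.Prime.coprime_iff_not_dvd hp).2
    (mt (CharP.cast_eq_zero_iff F p n).2 hn)).pow_left m).symm

theorem frobeniusAlgHom_eq_mapDomainAlgHom :
    FiniteField.frobeniusAlgHom F (MonoidAlgebra F G) =
      mapDomainAlgHom F F (powMonoidHom (Fintype.card F)) := by
  refine algHom_ext (fun g => ?_) (by ext)
  rw [FiniteField.frobeniusAlgHom_apply, single_pow, one_pow, mapDomainAlgHom_apply,
    mapDomain_single, powMonoidHom_apply]

variable [NeZero (Nat.card G : F)] {f : MonoidAlgebra F G}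

theorem coeff_pow_card (hf : f ^ Fintype.card F = f) (g : G) :
    f.coeff (g ^ Fintype.card F) = f.coeff g := by
  have hinj : Function.Injective (powMonoidHom (Fintype.card F) : G →* G) :=
    (powCoprime (coprime_card_of_natCast_ne_zero (NeZero.ne (Nat.card G : F)))).injective
  have hmap : mapDomain (powMonoidHom (Fintype.card F) : G →* G) f = f :=
    (DFunLike.congr_fun frobeniusAlgHom_eq_mapDomainAlgHom f).symm.trans hf
  conv_lhs => rw [← hmap]
  exact Finsupp.mapDomain_apply hinj _ _

theorem coeff_pow_card_pow (hf : f ^ Fintype.card F = f) (g : G) (k : ℕ) :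
    f.coeff (g ^ Fintype.card F ^ k) = f.coeff g := by
  induction k with
  | zero => rw [pow_zero, pow_one]
  | succ k ih => rw [pow_succ, pow_mul, coeff_pow_card hf, ih]

theorem exists_pow_pow_eq_of_zpowers_eq {G : Type*} [Group G] [Finite G] {q : ℕ}
    {u : (ZMod (Monoid.exponent G))ˣ} (huq : (u : ZMod (Monoid.exponent G)) = q)
    (hu : zpowers u = ⊤) {g g' : G} (hgg' : zpowers g = zpowers g') :
    ∃ k : ℕ, g ^ q ^ k = g' := by
  have : NeZero (Monoid.exponent G) := ⟨Monoid.exponent_ne_zero_of_finite⟩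
  obtain ⟨z, rfl⟩ := mem_zpowers_iff.1 (hgg' ▸ mem_zpowers g')
  have hcop : IsCoprime z (orderOf g) := by
    rw [Int.isCoprime_iff_gcd_eq_one, ← mem_zpowers_zpow_iff, ← hgg']
    exact mem_zpowers g
  obtain ⟨v, hv⟩ := ZMod.unitsMap_surjective (Monoid.order_dvd_exponent g)
    (ZMod.unitOfIsCoprime z hcop)
  obtain ⟨k, rfl⟩ := mem_powers_iff_mem_zpowers.2 (hu ▸ mem_top v)
  refine ⟨k, ?_⟩
  have hz : (q ^ k : ZMod (orderOf g)) = z := by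
    rw [← ZMod.coe_unitOfIsCoprime z hcop, ← hv, map_pow, Units.val_pow_eq_pow_val,
      ZMod.unitsMap_val, huq, ZMod.cast_natCast (Monoid.order_dvd_exponent g)]
  rw [← zpow_natCast, zpow_eq_zpow_iff_modEq, ← ZMod.intCast_eq_intCast_iff, ← hz]
  push_cast
  rfl

theorem coeff_eq_of_zpowers_eq {u : (ZMod (Monoid.exponent G))ˣ}
    (huq : (u : ZMod (Monoid.exponent G)) = Fintype.card F) (hu : zpowers u = ⊤)
    (hf : f ^ Fintype.card F = f) {g g' : G} (hgg' : zpowers g = zpowers g') :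
    f.coeff g = f.coeff g' := by
  have := finite_of_natCast_card_ne_zero F G
  obtain ⟨k, rfl⟩ := exists_pow_pow_eq_of_zpowers_eq huq hu hgg'
  exact (coeff_pow_card_pow hf g k).symm

theorem mem_span_of_pow_card_eq {u : (ZMod (Monoid.exponent G))ˣ}
    (huq : (u : ZMod (Monoid.exponent G)) = Fintype.card F) (hu : zpowers u = ⊤)
    {ι : Type*} [Finite ι] {r : ι → G} (hr : ∀ g, ∃ k, zpowers g = zpowers (r k))
    {E : ι → MonoidAlgebra F G} (hE : OrthogonalIdempotents E) (hne : ∀ k, E k ≠ 0)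
    (hf : f ^ Fintype.card F = f) : f ∈ Submodule.span F (Set.range E) := by
  let fixed : Submodule F (MonoidAlgebra F G) :=
    LinearMap.eqLocus (FiniteField.frobeniusAlgHom F _).toLinearMap LinearMap.id
  have mem_fixed (x : MonoidAlgebra F G) : x ∈ fixed ↔ x ^ Fintype.card F = x := Iff.rfl
  let values : MonoidAlgebra F G →ₗ[F] ι → F :=
    LinearMap.pi fun k => Finsupp.lapply (r k) ∘ₗ (coeffLinearEquiv F).toLinearMap
  have hvalues : Set.InjOn values fixed := by
    intro x hx y hy hxy
    ext g
    obtain ⟨k, hk⟩ := hr g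
    rw [coeff_eq_of_zpowers_eq huq hu ((mem_fixed x).1 hx) hk,
      coeff_eq_of_zpowers_eq huq hu ((mem_fixed y).1 hy) hk]
    exact congrFun hxy k
  have hEfixed (k) : E k ∈ fixed := (mem_fixed _).2 ((hE.idem k).pow_eq Fintype.card_ne_zero)
  have hlin := linearIndependent_of_orthogonalIdempotents (F := F) hE hne
  have hle := le_span_range_of_injOn hlin hEfixed values hvalues
  exact hle ((mem_fixed f).2 hf)

end Frobenius

section GEquivalence

variable {F : Type*} [Field F] {G : Type*} [CommGroup G]

theorem image_domCongr_code (ψ : G ≃* G) (e : MonoidAlgebra F G) :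
    domCongr F F ψ '' (code e : Set (MonoidAlgebra F G)) = code (domCongr F F ψ e) := by
  ext x
  have map_span : Ideal.map (domCongr F F ψ) (code e) = code (domCongr F F ψ e) := by
    rw [code, Ideal.map_span, Set.image_singleton, code]
  rw [← map_span, SetLike.mem_coe,
    Ideal.mem_map_iff_of_surjective _ (domCongr F F ψ).surjective, Set.mem_image]
  rfl

theorem gEquivalent_code_domCongr (ψ : G ≃* G) (e : MonoidAlgebra F G) :
    GEquivalent (code e) (code (domCongr F F ψ e)) :=
  ⟨ψ, image_domCongr_code ψ e⟩

theorem GEquivalent.exists_domCongr_eq {e f : MonoidAlgebra F G} (he : IsIdempotentElem e)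
    (hf : IsIdempotentElem f) (hef : GEquivalent (code e) (code f)) :
    ∃ ψ : G ≃* G, domCongr F F ψ e = f := by
  obtain ⟨ψ, hψ⟩ := hef
  rw [image_domCongr_code] at hψ
  exact ⟨ψ, eq_of_span_singleton_eq_of_isIdempotentElem (he.map (domCongr F F ψ)) hf
    (SetLike.coe_injective hψ)⟩

theorem elemWeight_domCongr (ψ : G ≃* G) (x : MonoidAlgebra F G) :
    elemWeight (domCongr F F ψ x) = elemWeight x := by
  rw [elemWeight, domCongr_support, Finset.card_map, elemWeight]

theorem GEquivalent.weight_eq {I J : Ideal (MonoidAlgebra F G)} (hIJ : GEquivalent I J) :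
    weight I = weight J := by
  have weights_subset {I J : Ideal (MonoidAlgebra F G)} (hIJ : GEquivalent I J) :
      {n | ∃ x ∈ I, x ≠ 0 ∧ elemWeight x = n} ⊆ {n | ∃ x ∈ J, x ≠ 0 ∧ elemWeight x = n} := by
    obtain ⟨ψ, hψ⟩ := hIJ
    rintro n ⟨x, hx, hx0, rfl⟩
    have hψx : domCongr F F ψ x ∈ (J : Set (MonoidAlgebra F G)) := hψ ▸ Set.mem_image_of_mem _ hx
    exact ⟨domCongr F F ψ x, hψx, EmbeddingLike.map_ne_zero_iff.2 hx0, elemWeight_domCongr ψ x⟩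
  rw [weight, weight, (weights_subset hIJ).antisymm (weights_subset hIJ.symm)]

theorem GEquivalent.exists_map_eq [NeZero (Nat.card G : F)] {H K : Subgroup G}
    (hHK : GEquivalent (code (hat F H - hat F ⊤)) (code (hat F K - hat F ⊤))) :
    ∃ ψ : G ≃* G, H.map ψ.toMonoidHom = K := by
  have := finite_of_natCast_card_ne_zero F G
  obtain ⟨ψ, hψ⟩ := hHK.exists_domCongr_eq (isIdempotentElem_hat_sub_hat le_top)
    (isIdempotentElem_hat_sub_hat le_top)
  rw [map_sub, domCongr_hat, domCongr_hat, map_top_of_surjective ψ.toMonoidHom ψ.surjective,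
    sub_left_inj] at hψ
  exact ⟨ψ, hat_injective hψ⟩

end GEquivalence

section CyclicSubgroups

variable {G : Type*} [CommGroup G] {p : ℕ}

theorem zpowers_mul_sup_of_mem {H : Subgroup G} {z : G} (hz : z ∈ H) (y : G) :
    zpowers (y * z) ⊔ H = zpowers y ⊔ H := by
  refine le_antisymm (sup_le (zpowers_le.2 ?_) le_sup_right) (sup_le (zpowers_le.2 ?_) le_sup_right)
  · exact mul_mem (mem_sup_left (mem_zpowers y)) (mem_sup_right hz)
  · exact (mul_mem_cancel_right (mem_sup_right hz)).1 (mem_sup_left (mem_zpowers (y * z)))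

theorem pow_eq_one_of_mem_zpowers_sup_zpowers {x y g : G} {n : ℕ} (hx : x ^ n = 1)
    (hy : y ^ n = 1) (hg : g ∈ zpowers x ⊔ zpowers y) : g ^ n = 1 := by
  have hle : zpowers x ⊔ zpowers y ≤ (powMonoidHom n : G →* G).ker :=
    sup_le (zpowers_le.2 hx) (zpowers_le.2 hy)
  exact hle hg

theorem zpowers_zpow_eq_of_not_dvd (hp : p.Prime) {g : G} {k : ℕ} (hg : g ^ p ^ k = 1) {n : ℤ}
    (hn : ¬ (p : ℤ) ∣ n) : zpowers (g ^ n) = zpowers g := by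
  refine le_antisymm (zpowers_le.2 (zpow_mem (mem_zpowers g) n))
    (zpowers_le.2 (mem_zpowers_zpow_iff.2 ?_))
  have hcop : IsCoprime n ((p ^ k : ℕ) : ℤ) := by
    rw [Nat.cast_pow]
    exact ((Nat.prime_iff_prime_int.1 hp).coprime_iff_not_dvd.2 hn).symm.pow_right
  exact Int.isCoprime_iff_gcd_eq_one.1 (hcop.of_isCoprime_of_dvd_right
    (Int.natCast_dvd_natCast.2 (orderOf_dvd_of_pow_eq_one hg)))

theorem zpowers_mul_pow_sup_zpowers_mul_pow (hp : p.Prime) {x : G} (hx : x ^ p = 1) (y : G)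
    {i i' : ℕ} (hi : i < p) (hi' : i' < p) (hne : i ≠ i') :
    zpowers (y * x ^ i) ⊔ zpowers (y * x ^ i') = zpowers y ⊔ zpowers x := by
  have hdvd : ¬ (p : ℤ) ∣ (i : ℤ) - i' := fun h => by
    have := Int.eq_zero_of_abs_lt_dvd h (by rw [abs_lt]; omega)
    omega
  refine le_antisymm (sup_le (zpowers_le.2 ?_) (zpowers_le.2 ?_)) ?_
  · exact mul_mem (mem_sup_left (mem_zpowers y)) (mem_sup_right (pow_mem (mem_zpowers x) i))
  · exact mul_mem (mem_sup_left (mem_zpowers y)) (mem_sup_right (pow_mem (mem_zpowers x) i'))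
  have hmem : y * x ^ i ∈ zpowers (y * x ^ i) ⊔ zpowers (y * x ^ i') :=
    mem_sup_left (mem_zpowers _)
  have hxmem : zpowers x ≤ zpowers (y * x ^ i) ⊔ zpowers (y * x ^ i') := by
    rw [← zpowers_zpow_eq_of_not_dvd hp (k := 1) (by rwa [pow_one]) hdvd, zpowers_le, zpow_sub,
      zpow_natCast, zpow_natCast, ← div_eq_mul_inv, ← mul_div_mul_left_eq_div _ _ y]
    exact div_mem hmem (mem_sup_right (mem_zpowers _))
  refine sup_le (zpowers_le.2 ?_) hxmem
  exact (mul_mem_cancel_right (pow_mem (hxmem (mem_zpowers x)) i)).1 hmem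

theorem exists_zpowers_zpow_mul_zpow_eq (hp : p.Prime) {u v : G} {k : ℕ} (hu : u ^ p ^ (k + 1) = 1)
    (hv : v ^ p = 1) {m : ℤ} (hm : ¬ (p : ℤ) ∣ m) (n : ℤ) :
    ∃ i < p, zpowers (u ^ m * v ^ n) = zpowers (u * v ^ i) := by
  have := Fact.mk hp
  have hm0 : (m : ZMod p) ≠ 0 := mt (ZMod.intCast_zmod_eq_zero_iff_dvd m p).1 hm
  let i := ((n : ZMod p) * (m : ZMod p)⁻¹).val
  have hdvd : (p : ℤ) ∣ n - i * m := by
    rw [← ZMod.intCast_zmod_eq_zero_iff_dvd]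
    push_cast
    rw [ZMod.natCast_zmod_val, inv_mul_cancel_right₀ hm0, sub_self]
  have hvn : v ^ n = (v ^ i) ^ m := by
    rw [← zpow_natCast, ← zpow_mul, zpow_eq_zpow_iff_modEq]
    exact (Int.modEq_iff_dvd.2 ((Int.natCast_dvd_natCast.2
      (orderOf_dvd_of_pow_eq_one hv)).trans hdvd)).symm
  have huv : (u * v ^ i) ^ p ^ (k + 1) = 1 := by
    rw [mul_pow, hu, pow_succ', pow_mul, pow_right_comm v, hv, one_pow, one_pow, one_mul]
  refine ⟨i, ZMod.val_lt _, ?_⟩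
  rw [hvn, ← mul_zpow, zpowers_zpow_eq_of_not_dvd hp huv hm]

end CyclicSubgroups

section Complements

variable {G : Type*} [CommGroup G]

theorem range_subtype_coprod_subtype (H K : Subgroup G) :
    (H.subtype.coprod K.subtype).range = H ⊔ K := by
  ext g
  rw [MonoidHom.mem_range, mem_sup']
  exact Prod.exists

theorem card_sup_of_disjoint {H K : Subgroup G} (hHK : Disjoint H K) :
    Nat.card (H ⊔ K : Subgroup G) = Nat.card H * Nat.card K := by
  rw [← range_subtype_coprod_subtype, ← Nat.card_prod]
  exact Nat.card_range_of_injective (mul_injective_of_disjoint hHK)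

theorem exists_monoidHom_of_isCompl_zpowers {G' : Type*} [CommGroup G'] {a b : G}
    (hab : IsCompl (zpowers a) (zpowers b)) {x y : G'} (hx : orderOf x ∣ orderOf a)
    (hy : orderOf y ∣ orderOf b) : ∃ φ : G →* G', φ a = x ∧ φ b = y := by
  have hgen (c : G) (z : zpowers c) : z ∈ zpowers (⟨c, mem_zpowers c⟩ : zpowers c) := by
    obtain ⟨_, k, rfl⟩ := z
    exact ⟨k, rfl⟩
  let e : zpowers a × zpowers b ≃* G :=
    MulEquiv.ofBijective ((zpowers a).subtype.coprod (zpowers b).subtype)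
      ⟨mul_injective_of_disjoint hab.disjoint, MonoidHom.range_eq_top.1 <|
        (range_subtype_coprod_subtype _ _).trans hab.sup_eq_top⟩
  have ha : e.symm a = (⟨a, mem_zpowers a⟩, 1) := e.symm_apply_eq.2 (mul_one a).symm
  have hb : e.symm b = (1, ⟨b, mem_zpowers b⟩) := e.symm_apply_eq.2 (one_mul b).symm
  refine ⟨((monoidHomOfForallMemZpowers (hgen a) (by rwa [orderOf_mk])).coprod
    (monoidHomOfForallMemZpowers (hgen b) (by rwa [orderOf_mk]))).comp e.symm.toMonoidHom, ?_, ?_⟩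
  · simp [ha]
  · simp [hb]

theorem exists_mulEquiv_of_isCompl_zpowers [Finite G] {a b : G}
    (hab : IsCompl (zpowers a) (zpowers b)) {x y : G} (hx : orderOf x ∣ orderOf a)
    (hy : orderOf y ∣ orderOf b) (hxy : zpowers x ⊔ zpowers y = ⊤) :
    ∃ ψ : G ≃* G, ψ a = x ∧ ψ b = y := by
  obtain ⟨φ, rfl, rfl⟩ := exists_monoidHom_of_isCompl_zpowers hab hx hy
  have hsurj : Function.Surjective φ := by
    rw [← MonoidHom.range_eq_top, eq_top_iff, ← hxy]
    exact sup_le (zpowers_le.2 ⟨a, rfl⟩) (zpowers_le.2 ⟨b, rfl⟩)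
  exact ⟨MulEquiv.ofBijective φ hsurj.bijective_of_finite, rfl, rfl⟩

theorem isCompl_zpowers_prodMk {G' : Type*} [CommGroup G'] {g : G} {g' : G'}
    (hg : zpowers g = ⊤) (hg' : zpowers g' = ⊤) :
    IsCompl (zpowers ((g, 1) : G × G')) (zpowers ((1, g') : G × G')) := by
  have hle_ker_snd : zpowers ((g, 1) : G × G') ≤ (MonoidHom.snd G G').ker := zpowers_le.2 rfl
  have hle_ker_fst : zpowers ((1, g') : G × G') ≤ (MonoidHom.fst G G').ker := zpowers_le.2 rfl
  refine ⟨disjoint_def.2 fun hx hx' => Prod.ext (hle_ker_fst hx') (hle_ker_snd hx),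
    codisjoint_iff.2 ((eq_top_iff' _).2 fun x => ?_)⟩
  obtain ⟨m, hm⟩ := mem_zpowers_iff.1 ((eq_top_iff' _).1 hg x.1)
  obtain ⟨n, hn⟩ := mem_zpowers_iff.1 ((eq_top_iff' _).1 hg' x.2)
  exact mem_sup.2 ⟨(x.1, 1), ⟨m, Prod.ext hm (one_zpow m)⟩, (1, x.2),
    ⟨n, Prod.ext (one_zpow n) hn⟩, Prod.ext (mul_one x.1) (one_mul x.2)⟩

end Complements

section SqPrimeBasis

/-- `(a, b)` is a basis of type `(p², p)` of the abelian group `G`, for a prime `p`: `G` is the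
internal direct product of `⟨a⟩`, of order `p²`, and `⟨b⟩`, of order `p`. -/
structure IsSqPrimeBasis (p : ℕ) {G : Type*} [CommGroup G] (a b : G) : Prop where
  prime : p.Prime
  orderOf_left : orderOf a = p ^ 2
  orderOf_right : orderOf b = p
  isCompl : IsCompl (zpowers a) (zpowers b)

namespace IsSqPrimeBasis

variable {p : ℕ} {G : Type*} [CommGroup G] {a b : G} (h : IsSqPrimeBasis p a b)

include h

theorem left_pow : a ^ p ^ 2 = 1 :=
  orderOf_dvd_iff_pow_eq_one.1 h.orderOf_left.dvd

theorem right_pow : b ^ p = 1 :=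
  orderOf_dvd_iff_pow_eq_one.1 h.orderOf_right.dvd

theorem left_pow_pow : (a ^ p) ^ p = 1 := by
  rw [← pow_mul, ← sq, h.left_pow]

theorem orderOf_left_pow : orderOf (a ^ p) = p := by
  rw [orderOf_pow_of_dvd h.prime.ne_zero (h.orderOf_left ▸ dvd_pow_self p two_ne_zero),
    h.orderOf_left, sq, Nat.mul_div_cancel _ h.prime.pos]

theorem card_eq : Nat.card G = p ^ 3 := by
  rw [← card_top, ← h.isCompl.sup_eq_top, card_sup_of_disjoint h.isCompl.disjoint,
    Nat.card_zpowers, Nat.card_zpowers, h.orderOf_left, h.orderOf_right, ← pow_succ]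

theorem finite : Finite G :=
  Nat.finite_of_card_ne_zero (h.card_eq ▸ pow_ne_zero 3 h.prime.ne_zero)

theorem exponent_eq : Monoid.exponent G = p ^ 2 := by
  refine dvd_antisymm (Monoid.exponent_dvd_of_forall_pow_eq_one fun g => ?_)
    (h.orderOf_left ▸ Monoid.order_dvd_exponent a)
  refine pow_eq_one_of_mem_zpowers_sup_zpowers h.left_pow ?_ (h.isCompl.sup_eq_top ▸ mem_top g)
  rw [sq, pow_mul, h.right_pow, one_pow]

theorem card_zpowers_pow_sup_zpowers :
    Nat.card (zpowers (a ^ p) ⊔ zpowers b : Subgroup G) = p ^ 2 := by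
  have hle : zpowers (a ^ p) ≤ zpowers a := zpowers_le.2 (pow_mem (mem_zpowers a) p)
  rw [card_sup_of_disjoint (h.isCompl.disjoint.mono_left hle), Nat.card_zpowers, Nat.card_zpowers,
    h.orderOf_left_pow, h.orderOf_right, sq]

theorem index_eq_pow {H : Subgroup G} {m n : ℕ} (hH : Nat.card H = p ^ m) (hmn : m + n = 3) :
    H.index = p ^ n := by
  refine Nat.eq_of_mul_eq_mul_left (pow_pos h.prime.pos m) ?_
  rw [← hH, H.card_mul_index, h.card_eq, hH, ← pow_add, hmn]

theorem zpowers_pow_sup_zpowers_lt_top : zpowers (a ^ p) ⊔ zpowers b < ⊤ := by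
  refine lt_top_iff_ne_top.2 fun htop => ?_
  have hdvd : p ^ 2 ∣ p := h.orderOf_left ▸ orderOf_dvd_of_pow_eq_one
    (pow_eq_one_of_mem_zpowers_sup_zpowers h.left_pow_pow h.right_pow (htop ▸ mem_top a))
  exact (Nat.le_of_dvd h.prime.pos hdvd).not_gt (lt_self_pow₀ h.prime.one_lt one_lt_two)

theorem map {G' : Type*} [CommGroup G'] (ψ : G ≃* G') : IsSqPrimeBasis p (ψ a) (ψ b) where
  prime := h.prime
  orderOf_left := (MulEquiv.orderOf_eq ψ a).trans h.orderOf_left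
  orderOf_right := (MulEquiv.orderOf_eq ψ b).trans h.orderOf_right
  isCompl := by
    have hmap := ψ.mapSubgroup.isCompl_iff.1 h.isCompl
    simp only [MulEquiv.mapSubgroup_apply, MonoidHom.map_zpowers] at hmap
    exact hmap

theorem shear (i j : ℕ) : IsSqPrimeBasis p (a * b ^ i) (a ^ (j * p) * b) := by
  have := h.finite
  set S := zpowers (a * b ^ i) ⊔ zpowers (a ^ (j * p) * b)
  have left_mem : a * b ^ i ∈ S := mem_sup_left (mem_zpowers _)
  have right_mem : a ^ (j * p) * b ∈ S := mem_sup_right (mem_zpowers _)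
  have left_pow_eq : (a * b ^ i) ^ p = a ^ p := by
    rw [mul_pow, pow_right_comm, h.right_pow, one_pow, mul_one]
  have hb : b ∈ S := by
    refine (mul_mem_cancel_left ?_).1 right_mem
    rw [mul_comm, pow_mul, ← left_pow_eq]
    exact pow_mem (pow_mem left_mem p) j
  have ha : a ∈ S := (mul_mem_cancel_right (pow_mem hb i)).1 left_mem
  have hS : S = ⊤ := by
    rw [eq_top_iff, ← h.isCompl.sup_eq_top]
    exact sup_le (zpowers_le.2 ha) (zpowers_le.2 hb)
  have horder_left : orderOf (a * b ^ i) ∣ orderOf a := by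
    rw [h.orderOf_left, ← h.exponent_eq]
    exact Monoid.order_dvd_exponent _
  have horder_right : orderOf (a ^ (j * p) * b) ∣ orderOf b := by
    rw [h.orderOf_right, orderOf_dvd_iff_pow_eq_one, mul_pow, h.right_pow, mul_one, ← pow_mul,
      mul_assoc, mul_comm, pow_mul, ← sq, h.left_pow, one_pow]
  obtain ⟨ψ, hψa, hψb⟩ :=
    exists_mulEquiv_of_isCompl_zpowers h.isCompl horder_left horder_right hS
  exact hψa ▸ hψb ▸ h.map ψ

theorem exists_mulEquiv {a' b' : G} (h' : IsSqPrimeBasis p a' b') :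
    ∃ ψ : G ≃* G, ψ a = a' ∧ ψ b = b' := by
  have := h.finite
  refine exists_mulEquiv_of_isCompl_zpowers h.isCompl ?_ ?_ h'.isCompl.sup_eq_top
  · rw [h.orderOf_left, h'.orderOf_left]
  · rw [h.orderOf_right, h'.orderOf_right]

theorem zpowers_eq_cases (g : G) : zpowers g = zpowers 1 ∨ zpowers g = zpowers (a ^ p) ∨
    (∃ j < p, zpowers g = zpowers (a ^ (j * p) * b)) ∨
      ∃ i < p, zpowers g = zpowers (a * b ^ i) := by
  obtain ⟨_, ⟨m, rfl⟩, _, ⟨n, rfl⟩, rfl⟩ := mem_sup.1 (h.isCompl.sup_eq_top ▸ mem_top g)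
  dsimp only
  by_cases hm : (p : ℤ) ∣ m
  · obtain ⟨m', rfl⟩ := hm
    rw [zpow_mul, zpow_natCast]
    by_cases hn : (p : ℤ) ∣ n
    · obtain ⟨n', rfl⟩ := hn
      rw [zpow_mul, zpow_natCast, h.right_pow, one_zpow, mul_one]
      by_cases hm' : (p : ℤ) ∣ m'
      · obtain ⟨m'', rfl⟩ := hm'
        rw [zpow_mul, zpow_natCast, h.left_pow_pow, one_zpow]
        exact Or.inl rfl
      · refine Or.inr (Or.inl (zpowers_zpow_eq_of_not_dvd h.prime (k := 1) ?_ hm'))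
        rw [pow_one, h.left_pow_pow]
    · obtain ⟨j, hj, hjeq⟩ := exists_zpowers_zpow_mul_zpow_eq h.prime (k := 0)
        (by rw [zero_add, pow_one, h.right_pow]) h.left_pow_pow hn m'
      refine Or.inr (Or.inr (Or.inl ⟨j, hj, ?_⟩))
      rw [mul_comm, hjeq, ← pow_mul, mul_comm p j, mul_comm b]
  · obtain ⟨i, hi, hieq⟩ :=
      exists_zpowers_zpow_mul_zpow_eq h.prime (k := 1) h.left_pow h.right_pow hm n
    exact Or.inr (Or.inr (Or.inr ⟨i, hi, hieq⟩))

end IsSqPrimeBasis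

end SqPrimeBasis

section MinimalCodes

/-- Representatives of the cyclic subgroups `1`, `⟨a ^ p⟩`, `⟨a ^ (j * p) * b⟩`, `⟨a * b ^ i⟩`. -/
def cyclicRep (p : ℕ) {G : Type*} [CommGroup G] (a b : G) : Unit ⊕ Unit ⊕ Fin p ⊕ Fin p → G :=
  Sum.elim (fun _ => 1) (Sum.elim (fun _ => a ^ p)
    (Sum.elim (fun j => a ^ (j * p : ℕ) * b) fun i => a * b ^ (i : ℕ)))

/-- The family of all idempotents `e₀`, `e₃`, `e₁ j`, `e₂ i`, indexed as in `cyclicRep`, so that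
there are as many idempotents as cyclic subgroups. -/
def primIdem (p : ℕ) {G : Type*} [CommGroup G] (a b : G) :
    Unit ⊕ Unit ⊕ Fin p ⊕ Fin p → MonoidAlgebra (ZMod 2) G :=
  Sum.elim (fun _ => e₀ G) (Sum.elim (fun _ => e₃ p a b)
    (Sum.elim (fun j => e₁ p a b j) fun i => e₂ a b i))

variable {p : ℕ} {G : Type*} [CommGroup G] {a b : G}

theorem zpowers_left_pow_mul (j : ℕ) :
    zpowers (a ^ (j * p) * b) = zpowers (b * (a ^ p) ^ j) := by
  rw [mul_comm, mul_comm j, pow_mul]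

theorem zpowers_left_pow_mul_le (j : ℕ) :
    zpowers (a ^ (j * p) * b) ≤ zpowers (a ^ p) ⊔ zpowers b := by
  rw [zpowers_left_pow_mul, zpowers_le]
  exact mul_mem (mem_sup_right (mem_zpowers b)) (mem_sup_left (pow_mem (mem_zpowers _) j))

namespace IsSqPrimeBasis

variable (h : IsSqPrimeBasis p a b)

include h

theorem zpowers_left_pow_mul_lt (j : ℕ) :
    zpowers (a ^ (j * p) * b) < zpowers (a ^ p) ⊔ zpowers b := by
  refine (zpowers_left_pow_mul_le j).lt_of_ne fun heq => ?_
  have hcard := h.card_zpowers_pow_sup_zpowers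
  rw [← heq, Nat.card_zpowers, (h.shear 0 j).orderOf_right] at hcard
  exact (lt_self_pow₀ h.prime.one_lt one_lt_two).ne hcard

theorem zpowers_mul_right_pow_lt_top (i : ℕ) : zpowers (a * b ^ i) < ⊤ := by
  refine lt_top_iff_ne_top.2 fun htop => ?_
  have hcard := h.card_eq
  rw [← card_top, ← htop, Nat.card_zpowers, (h.shear i 0).orderOf_left] at hcard
  exact (pow_lt_pow_right₀ h.prime.one_lt (Nat.lt_succ_self 2)).ne hcard

theorem exists_zpowers_eq_cyclicRep (g : G) : ∃ k, zpowers g = zpowers (cyclicRep p a b k) := by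
  rcases h.zpowers_eq_cases g with hg | hg | ⟨j, hj, hg⟩ | ⟨i, hi, hg⟩
  · exact ⟨Sum.inl (), hg⟩
  · exact ⟨Sum.inr (Sum.inl ()), hg⟩
  · exact ⟨Sum.inr (Sum.inr (Sum.inl ⟨j, hj⟩)), hg⟩
  · exact ⟨Sum.inr (Sum.inr (Sum.inr ⟨i, hi⟩)), hg⟩

section Odd

variable (hodd : Odd p)

include hodd

theorem odd_card : Odd (Nat.card G) :=
  h.card_eq ▸ hodd.pow

theorem neZero_card : NeZero (Nat.card G : ZMod 2) :=
  ⟨by rw [ZMod.natCast_eq_one_iff_odd.2 (h.odd_card hodd)]; exact one_ne_zero⟩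

theorem orthogonalIdempotents_e₁ : OrthogonalIdempotents fun j : Fin p => e₁ p a b j where
  idem j :=
    have := h.neZero_card hodd
    isIdempotentElem_hat_sub_hat (zpowers_left_pow_mul_le _)
  ortho j j' hjj' := by
    have := h.neZero_card hodd
    refine hat_sub_hat_mul_hat_sub_hat_eq_zero (zpowers_left_pow_mul_le _) ?_
      (zpowers_left_pow_mul_le _)
    rw [zpowers_left_pow_mul, zpowers_left_pow_mul, sup_comm]
    exact (zpowers_mul_pow_sup_zpowers_mul_pow h.prime h.left_pow_pow b j.2 j'.2
      (Fin.val_ne_of_ne hjj')).ge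

theorem orthogonalIdempotents_e₂ : OrthogonalIdempotents fun i : Fin p => e₂ a b i where
  idem i :=
    have := h.neZero_card hodd
    isIdempotentElem_hat_sub_hat le_top
  ortho i i' hii' := by
    have := h.neZero_card hodd
    refine hat_sub_hat_mul_hat_sub_hat_eq_zero le_top ?_ le_top
    rw [zpowers_mul_pow_sup_zpowers_mul_pow h.prime h.right_pow a i.2 i'.2
      (Fin.val_ne_of_ne hii'), h.isCompl.sup_eq_top]

theorem e₁_mul_e₂ (j i : ℕ) : e₁ p a b j * e₂ a b i = 0 := by
  have := h.neZero_card hodd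
  refine hat_sub_hat_mul_hat_sub_hat_eq_zero (zpowers_left_pow_mul_le j) ?_ le_top
  rw [sup_comm (zpowers (a ^ (j * p) * b)), (h.shear i j).isCompl.sup_eq_top]
  exact le_top

theorem e₁_mul_e₃ (j : ℕ) : e₁ p a b j * e₃ p a b = 0 :=
  have := h.neZero_card hodd
  hat_sub_hat_mul_hat_sub_hat_eq_zero (zpowers_left_pow_mul_le j) le_sup_right le_top

theorem e₂_mul_e₃ (i : ℕ) : e₂ a b i * e₃ p a b = 0 := by
  have := h.neZero_card hodd
  refine hat_sub_hat_mul_hat_sub_hat_eq_zero le_top ?_ le_top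
  have hcompl := (h.shear i 0).isCompl.sup_eq_top
  rw [zero_mul, pow_zero, one_mul] at hcompl
  rw [← hcompl]
  exact sup_le_sup_left le_sup_right _

theorem e₁_mul_e₀ (j : ℕ) : e₁ p a b j * e₀ G = 0 :=
  have := h.neZero_card hodd
  hat_sub_hat_mul_hat_eq_zero (zpowers_left_pow_mul_le j) (le_top.trans le_sup_right)

theorem e₂_mul_e₀ (i : ℕ) : e₂ a b i * e₀ G = 0 :=
  have := h.neZero_card hodd
  hat_sub_hat_mul_hat_eq_zero le_top le_sup_right

theorem e₃_mul_e₀ : e₃ p a b * e₀ G = 0 :=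
  have := h.neZero_card hodd
  hat_sub_hat_mul_hat_eq_zero le_top le_sup_right

theorem orthogonalIdempotents_primIdem : OrthogonalIdempotents (primIdem p a b) := by
  have := h.neZero_card hodd
  have hsingle {e : MonoidAlgebra (ZMod 2) G} (he : IsIdempotentElem e) :
      OrthogonalIdempotents fun _ : Unit => e :=
    ⟨fun _ => he, fun k l hkl => (hkl (Subsingleton.elim k l)).elim⟩
  refine orthogonalIdempotents_sumElim (hsingle (isIdempotentElem_hat ⊤))
    (orthogonalIdempotents_sumElim (hsingle (isIdempotentElem_hat_sub_hat le_top))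
      (orthogonalIdempotents_sumElim (h.orthogonalIdempotents_e₁ hodd)
        (h.orthogonalIdempotents_e₂ hodd) fun j i => h.e₁_mul_e₂ hodd j i) ?_) ?_
  · rintro - (j | i) <;> rw [mul_comm]
    exacts [h.e₁_mul_e₃ hodd j, h.e₂_mul_e₃ hodd i]
  · rintro - (- | j | i) <;> rw [mul_comm]
    exacts [h.e₃_mul_e₀ hodd, h.e₁_mul_e₀ hodd j, h.e₂_mul_e₀ hodd i]

theorem primIdem_ne_zero : ∀ k, primIdem p a b k ≠ 0 := by
  have := h.neZero_card hodd
  rintro (- | - | j | i)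
  · exact hat_ne_zero ⊤
  · exact sub_ne_zero.2 (hat_injective.ne h.zpowers_pow_sup_zpowers_lt_top.ne)
  · exact sub_ne_zero.2 (hat_injective.ne (h.zpowers_left_pow_mul_lt j).ne)
  · exact sub_ne_zero.2 (hat_injective.ne (h.zpowers_mul_right_pow_lt_top i).ne)

theorem dim_e₀ : dim (code (e₀ G)) = 1 := by
  have := h.neZero_card hodd
  rw [e₀, dim_code_hat, index_top]

theorem weight_e₀ : weight (code (e₀ G)) = p ^ 3 := by
  have := h.neZero_card hodd
  rw [e₀, weight_code_hat, card_top, h.card_eq]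

theorem dim_e₁ (j : ℕ) : dim (code (e₁ p a b j)) = p ^ 2 - p := by
  have := h.neZero_card hodd
  have hcard : Nat.card (zpowers (a ^ (j * p) * b)) = p ^ 1 := by
    rw [Nat.card_zpowers, (h.shear 0 j).orderOf_right, pow_one]
  rw [e₁, dim_code_hat_sub_hat (zpowers_left_pow_mul_le j), h.index_eq_pow (n := 2) hcard rfl,
    h.index_eq_pow (n := 1) h.card_zpowers_pow_sup_zpowers rfl, pow_one]

theorem weight_e₁ (j : ℕ) : weight (code (e₁ p a b j)) = 2 * p := by
  have := h.neZero_card hodd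
  rw [e₁, weight_code_hat_sub_hat (h.zpowers_left_pow_mul_lt j), Nat.card_zpowers,
    (h.shear 0 j).orderOf_right]

theorem dim_e₂ (i : ℕ) : dim (code (e₂ a b i)) = p - 1 := by
  have := h.neZero_card hodd
  have hcard : Nat.card (zpowers (a * b ^ i)) = p ^ 2 := by
    rw [Nat.card_zpowers, (h.shear i 0).orderOf_left]
  rw [e₂, dim_code_hat_sub_hat le_top, h.index_eq_pow (n := 1) hcard rfl, index_top, pow_one]

theorem weight_e₂ (i : ℕ) : weight (code (e₂ a b i)) = 2 * p ^ 2 := by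
  have := h.neZero_card hodd
  rw [e₂, weight_code_hat_sub_hat (h.zpowers_mul_right_pow_lt_top i), Nat.card_zpowers,
    (h.shear i 0).orderOf_left]

theorem dim_e₃ : dim (code (e₃ p a b)) = p - 1 := by
  have := h.neZero_card hodd
  rw [e₃, dim_code_hat_sub_hat le_top,
    h.index_eq_pow (n := 1) h.card_zpowers_pow_sup_zpowers rfl, index_top, pow_one]

theorem weight_e₃ : weight (code (e₃ p a b)) = 2 * p ^ 2 := by
  have := h.neZero_card hodd
  rw [e₃, weight_code_hat_sub_hat h.zpowers_pow_sup_zpowers_lt_top,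
    h.card_zpowers_pow_sup_zpowers]

section TwoGenerates

variable (h2 : ∃ u : (ZMod (p ^ 2))ˣ, (u : ZMod (p ^ 2)) = 2 ∧ zpowers u = ⊤)

include h2

theorem mem_span_primIdem {f : MonoidAlgebra (ZMod 2) G} (hf : IsIdempotentElem f) :
    f ∈ Submodule.span (ZMod 2) (Set.range (primIdem p a b)) := by
  have := h.neZero_card hodd
  rw [← h.exponent_eq] at h2
  obtain ⟨u, hu2, hu⟩ := h2
  have hspan := mem_span_of_pow_card_eq (F := ZMod 2) (f := f) (by rw [hu2, ZMod.card]; rfl) hu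
    h.exists_zpowers_eq_cyclicRep (h.orthogonalIdempotents_primIdem hodd)
    (h.primIdem_ne_zero hodd) (by rw [ZMod.card, hf.pow_eq two_ne_zero])
  exact hspan

theorem isPrimitiveIdempotent_primIdem (k : Unit ⊕ Unit ⊕ Fin p ⊕ Fin p) :
    IsPrimitiveIdempotent (primIdem p a b k) :=
  isPrimitiveIdempotent_of_forall_mem_span (h.orthogonalIdempotents_primIdem hodd)
    (fun _ => h.mem_span_primIdem hodd h2) (h.primIdem_ne_zero hodd k)

theorem isMinimalCode_iff {I : Ideal (MonoidAlgebra (ZMod 2) G)} :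
    IsMinimalCode I ↔ ∃ k, I = code (primIdem p a b k) := by
  have := h.neZero_card hodd
  have := h.finite
  have complete : CompleteOrthogonalIdempotents (primIdem p a b) :=
    completeOrthogonalIdempotents_of_one_mem_span (h.orthogonalIdempotents_primIdem hodd)
      (h.mem_span_primIdem hodd h2 .one)
  exact isAtom_iff_exists_eq_span complete (h.isPrimitiveIdempotent_primIdem hodd h2)

theorem ncard_isMinimalCode :
    {I : Ideal (MonoidAlgebra (ZMod 2) G) | IsMinimalCode I}.ncard = 2 * p + 2 := by
  have hrange : {I : Ideal (MonoidAlgebra (ZMod 2) G) | IsMinimalCode I} =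
      Set.range fun k => Ideal.span {primIdem p a b k} :=
    Set.ext fun I => (h.isMinimalCode_iff hodd h2).trans (exists_congr fun _ => eq_comm)
  rw [hrange, Set.ncard_range_of_injective (span_singleton_injective_of_orthogonalIdempotents
    (h.orthogonalIdempotents_primIdem hodd) (h.primIdem_ne_zero hodd)), Nat.card_eq_fintype_card]
  simp only [Fintype.card_sum, Fintype.card_fin, Fintype.card_unit]
  omega

theorem isMinimalCode_iff_listed {I : Ideal (MonoidAlgebra (ZMod 2) G)} :
    IsMinimalCode I ↔ (I = code (e₀ G) ∨ (∃ j < p, I = code (e₁ p a b j)) ∨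
      (∃ i < p, I = code (e₂ a b i)) ∨ I = code (e₃ p a b)) := by
  rw [h.isMinimalCode_iff hodd h2]
  constructor
  · rintro ⟨- | - | j | i, rfl⟩
    exacts [.inl rfl, .inr (.inr (.inr rfl)), .inr (.inl ⟨j, j.2, rfl⟩),
      .inr (.inr (.inl ⟨i, i.2, rfl⟩))]
  · rintro (rfl | ⟨j, hj, rfl⟩ | ⟨i, hi, rfl⟩ | rfl)
    exacts [⟨.inl (), rfl⟩, ⟨.inr (.inr (.inl ⟨j, hj⟩)), rfl⟩, ⟨.inr (.inr (.inr ⟨i, hi⟩)), rfl⟩,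
      ⟨.inr (.inl ()), rfl⟩]

end TwoGenerates

end Odd

end IsSqPrimeBasis

end MinimalCodes

section Classes

variable {p : ℕ} {G : Type*} [CommGroup G] {a b : G}

theorem e₁_left_pow_mul (j : ℕ) : e₁ p a (a ^ (j * p) * b) 0 = e₁ p a b j := by
  have hsup : zpowers (a ^ p) ⊔ zpowers (a ^ (j * p) * b) = zpowers (a ^ p) ⊔ zpowers b := by
    rw [sup_comm, sup_comm (zpowers (a ^ p)), mul_comm, mul_comm j, pow_mul,
      zpowers_mul_sup_of_mem (pow_mem (mem_zpowers (a ^ p)) j)]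
  rw [e₁, e₁, hsup, zero_mul, pow_zero, one_mul]

theorem e₂_mul_right_pow (i : ℕ) : e₂ (a * b ^ i) b 0 = e₂ a b i := by
  rw [e₂, e₂, pow_zero, mul_one]

theorem domCongr_e₁ [Finite G] (ψ : G ≃* G) (j : ℕ) :
    domCongr (ZMod 2) (ZMod 2) ψ (e₁ p a b j) = e₁ p (ψ a) (ψ b) j := by
  rw [e₁, map_sub, domCongr_hat, domCongr_hat, Subgroup.map_sup]
  simp only [MonoidHom.map_zpowers, MulEquiv.toMonoidHom_eq_coe, MonoidHom.coe_coe, map_mul,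
    map_pow]
  rfl

theorem domCongr_e₂ [Finite G] (ψ : G ≃* G) (i : ℕ) :
    domCongr (ZMod 2) (ZMod 2) ψ (e₂ a b i) = e₂ (ψ a) (ψ b) i := by
  rw [e₂, map_sub, domCongr_hat, domCongr_hat, map_top_of_surjective ψ.toMonoidHom ψ.surjective]
  simp only [MonoidHom.map_zpowers, MulEquiv.toMonoidHom_eq_coe, MonoidHom.coe_coe, map_mul,
    map_pow]
  rfl

theorem rep_one (p : ℕ) (a b : G) : rep p a b 1 = e₁ p a b 0 := by
  rw [e₁, zero_mul, pow_zero, one_mul]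
  rfl

theorem rep_two (p : ℕ) (a b : G) : rep p a b 2 = e₂ a b 0 := by
  rw [e₂, pow_zero, mul_one]
  rfl

namespace IsSqPrimeBasis

variable (h : IsSqPrimeBasis p a b)

include h

theorem gEquivalent_e₁ (j : ℕ) : GEquivalent (code (e₁ p a b 0)) (code (e₁ p a b j)) := by
  have := h.finite
  have hshear : IsSqPrimeBasis p a (a ^ (j * p) * b) := by simpa using h.shear 0 j
  obtain ⟨ψ, hψa, hψb⟩ := h.exists_mulEquiv hshear
  have hψ := gEquivalent_code_domCongr ψ (e₁ p a b 0)
  rwa [domCongr_e₁, hψa, hψb, e₁_left_pow_mul] at hψ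

theorem gEquivalent_e₂ (i : ℕ) : GEquivalent (code (e₂ a b 0)) (code (e₂ a b i)) := by
  have := h.finite
  have hshear : IsSqPrimeBasis p (a * b ^ i) b := by simpa using h.shear i 0
  obtain ⟨ψ, hψa, hψb⟩ := h.exists_mulEquiv hshear
  have hψ := gEquivalent_code_domCongr ψ (e₂ a b 0)
  rwa [domCongr_e₂, hψa, hψb, e₂_mul_right_pow] at hψ

theorem exists_rep_gEquivalent_primIdem (l : Unit ⊕ Unit ⊕ Fin p ⊕ Fin p) :
    ∃ k, GEquivalent (code (rep p a b k)) (code (primIdem p a b l)) := by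
  rcases l with - | - | j | i
  · exact ⟨0, GEquivalent.refl _⟩
  · exact ⟨3, GEquivalent.refl _⟩
  · exact ⟨1, rep_one p a b ▸ h.gEquivalent_e₁ j⟩
  · exact ⟨2, rep_two p a b ▸ h.gEquivalent_e₂ i⟩

theorem rep_mem_range_primIdem (k : Fin 4) : rep p a b k ∈ Set.range (primIdem p a b) := by
  fin_cases k
  exacts [⟨.inl (), rfl⟩, ⟨.inr (.inr (.inl ⟨0, h.prime.pos⟩)), (rep_one p a b).symm⟩,
    ⟨.inr (.inr (.inr ⟨0, h.prime.pos⟩)), (rep_two p a b).symm⟩, ⟨.inr (.inl ()), rfl⟩]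

section Odd

variable (hodd : Odd p)

include hodd

theorem not_gEquivalent_e₂_e₃ : ¬ GEquivalent (code (e₂ a b 0)) (code (e₃ p a b)) := by
  have := h.neZero_card hodd
  intro h23
  obtain ⟨ψ, hψ⟩ := h23.exists_map_eq
  rw [pow_zero, mul_one] at hψ
  have hmem : ψ a ∈ zpowers (a ^ p) ⊔ zpowers b := hψ ▸ mem_map_of_mem _ (mem_zpowers a)
  have hpow : a ^ p = 1 := by
    have := pow_eq_one_of_mem_zpowers_sup_zpowers h.left_pow_pow h.right_pow hmem
    rwa [← map_pow, EmbeddingLike.map_eq_one_iff] at this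
  exact h.prime.one_lt.ne (orderOf_one.symm.trans (hpow ▸ h.orderOf_left_pow))

theorem weight_rep (k : Fin 4) :
    weight (code (rep p a b k)) = ![p ^ 3, 2 * p, 2 * p ^ 2, 2 * p ^ 2] k := by
  fin_cases k
  · exact h.weight_e₀ hodd
  · exact (congrArg (weight <| code ·) (rep_one p a b)).trans (h.weight_e₁ hodd 0)
  · exact (congrArg (weight <| code ·) (rep_two p a b)).trans (h.weight_e₂ hodd 0)
  · exact h.weight_e₃ hodd

theorem not_gEquivalent_rep_of_lt {k l : Fin 4} (hkl : k < l) :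
    ¬ GEquivalent (code (rep p a b k)) (code (rep p a b l)) := by
  have hne_even (n : ℕ) : p ^ 3 ≠ 2 * n := fun hn =>
    Nat.not_even_iff_odd.2 hodd.pow (hn ▸ even_two_mul n)
  have hne_sq : 2 * p ≠ 2 * p ^ 2 :=
    fun hp => (lt_self_pow₀ h.prime.one_lt one_lt_two).ne (Nat.eq_of_mul_eq_mul_left two_pos hp)
  intro hequiv
  have hw := hequiv.weight_eq
  rw [h.weight_rep hodd, h.weight_rep hodd] at hw
  fin_cases k <;> fin_cases l <;> first | exact absurd hkl (by decide) | skip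
  · exact hne_even _ hw
  · exact hne_even _ hw
  · exact hne_even _ hw
  · exact hne_sq hw
  · exact hne_sq hw
  · exact h.not_gEquivalent_e₂_e₃ hodd (rep_two p a b ▸ hequiv)

theorem not_gEquivalent_rep {k l : Fin 4} (hkl : k ≠ l) :
    ¬ GEquivalent (code (rep p a b k)) (code (rep p a b l)) := by
  rcases hkl.lt_or_gt with hlt | hlt
  · exact h.not_gEquivalent_rep_of_lt hodd hlt
  · exact fun hequiv => h.not_gEquivalent_rep_of_lt hodd hlt hequiv.symm

variable (h2 : ∃ u : (ZMod (p ^ 2))ˣ, (u : ZMod (p ^ 2)) = 2 ∧ zpowers u = ⊤)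

include h2

theorem isMinimalCode_rep (k : Fin 4) : IsMinimalCode (code (rep p a b k)) := by
  obtain ⟨l, hl⟩ := h.rep_mem_range_primIdem k
  exact (h.isMinimalCode_iff hodd h2).2 ⟨l, congrArg code hl.symm⟩

theorem exists_rep_gEquivalent {I : Ideal (MonoidAlgebra (ZMod 2) G)} (hI : IsMinimalCode I) :
    ∃ k, GEquivalent (code (rep p a b k)) I := by
  obtain ⟨l, rfl⟩ := (h.isMinimalCode_iff hodd h2).1 hI
  exact h.exists_rep_gEquivalent_primIdem l

theorem numMinimalClasses_eq : numMinimalClasses (ZMod 2) G = 4 := by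
  let repClass (k : Fin 4) : Quotient (minimalCodeSetoid (ZMod 2) G) :=
    Quotient.mk _ ⟨code (rep p a b k), h.isMinimalCode_rep hodd h2 k⟩
  have hbij : Function.Bijective repClass := by
    refine ⟨fun k l hkl => ?_, Quotient.ind fun I => ?_⟩
    · by_contra hne
      exact h.not_gEquivalent_rep hodd hne (Quotient.exact hkl)
    · obtain ⟨k, hk⟩ := h.exists_rep_gEquivalent hodd h2 I.2
      exact ⟨k, Quotient.sound hk⟩
  rw [numMinimalClasses, ← Nat.card_congr (Equiv.ofBijective repClass hbij),
    Nat.card_eq_fintype_card, Fintype.card_fin]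

end Odd

end IsSqPrimeBasis

end Classes

section MillerClaim

variable {p : ℕ}

theorem card_divisors_prime_sq (hp : p.Prime) : (p ^ 2).divisors.card = 3 := by
  rw [Nat.divisors_prime_pow hp, Finset.card_map, Finset.card_range]

theorem IsSqPrimeBasis.not_millerClaim {G : Type*} [CommGroup G] {a b : G}
    (h : IsSqPrimeBasis p a b) (hodd : Odd p)
    (h2 : ∃ u : (ZMod (p ^ 2))ˣ, (u : ZMod (p ^ 2)) = 2 ∧ zpowers u = ⊤) :
    ¬ MillerClaim G := by
  intro hM
  have hfour := hM (h.odd_card hodd)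
  rw [h.numMinimalClasses_eq hodd h2, h.exponent_eq, card_divisors_prime_sq h.prime] at hfour
  exact absurd hfour (by decide)

theorem zpowers_ofAdd_one (n : ℕ) : zpowers (Multiplicative.ofAdd (1 : ZMod n)) = ⊤ :=
  (eq_top_iff' _).2 fun x => ⟨x.toAdd.cast, congrArg Multiplicative.ofAdd <|
    (zsmul_one _).trans (ZMod.intCast_zmod_cast x.toAdd)⟩

theorem isSqPrimeBasis_multiplicative_zmod_prod (hp : p.Prime) :
    IsSqPrimeBasis p (G := Multiplicative (ZMod (p ^ 2)) × Multiplicative (ZMod p))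
      (Multiplicative.ofAdd 1, 1) (1, Multiplicative.ofAdd 1) where
  prime := hp
  orderOf_left := by
    rw [Prod.orderOf_mk, orderOf_one, orderOf_ofAdd_eq_addOrderOf, ZMod.addOrderOf_one,
      Nat.lcm_one_right]
  orderOf_right := by
    rw [Prod.orderOf_mk, orderOf_one, orderOf_ofAdd_eq_addOrderOf, ZMod.addOrderOf_one,
      Nat.lcm_one_left]
  isCompl := isCompl_zpowers_prodMk (zpowers_ofAdd_one _) (zpowers_ofAdd_one _)

theorem exists_unit_zmod_nine_eq_two_zpowers_eq_top :
    ∃ u : (ZMod (3 ^ 2))ˣ, (u : ZMod (3 ^ 2)) = 2 ∧ zpowers u = ⊤ := by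
  refine ⟨ZMod.unitOfCoprime 2 (by decide), rfl, (eq_top_iff' _).2 fun x => ?_⟩
  have hpow : ∀ x : (ZMod 9)ˣ, ∃ k < 6,
      (ZMod.unitOfCoprime 2 (by decide : Nat.Coprime 2 9)) ^ k = x := by decide
  obtain ⟨k, -, hk⟩ := hpow x
  exact ⟨k, by simpa using hk⟩

end MillerClaim

end AbelianCode

end

theorem mainTheorem6 :
    (∀ (p : ℕ), p.Prime → Odd p →
      (∃ u : (ZMod (p ^ 2))ˣ, (u : ZMod (p ^ 2)) = 2 ∧ Subgroup.zpowers u = ⊤) →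
      ∀ (G : Type*) [CommGroup G] (a b : G),
        orderOf a = p ^ 2 → orderOf b = p →
        IsCompl (Subgroup.zpowers a) (Subgroup.zpowers b) →
        -- exactly four classes of minimal codes, with the four listed representatives
        ((∀ k : Fin 4, AbelianCode.IsMinimalCode
            (AbelianCode.code (AbelianCode.rep p a b k))) ∧
          (∀ k l : Fin 4, k ≠ l → ¬ AbelianCode.GEquivalent
            (AbelianCode.code (AbelianCode.rep p a b k))
            (AbelianCode.code (AbelianCode.rep p a b l))) ∧
          (∀ I : Ideal (MonoidAlgebra (ZMod 2) G), AbelianCode.IsMinimalCode I →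
            ∃ k : Fin 4, AbelianCode.GEquivalent
              (AbelianCode.code (AbelianCode.rep p a b k)) I) ∧
          AbelianCode.numMinimalClasses (ZMod 2) G = 4) ∧
        -- the list of all minimal codes, without repetitions
        ((∀ I : Ideal (MonoidAlgebra (ZMod 2) G), AbelianCode.IsMinimalCode I ↔
            (I = AbelianCode.code (AbelianCode.e₀ G) ∨
              (∃ j < p, I = AbelianCode.code (AbelianCode.e₁ p a b j)) ∨
              (∃ i < p, I = AbelianCode.code (AbelianCode.e₂ a b i)) ∨
              I = AbelianCode.code (AbelianCode.e₃ p a b))) ∧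
          {I : Ideal (MonoidAlgebra (ZMod 2) G) | AbelianCode.IsMinimalCode I}.ncard
            = 2 * p + 2) ∧
        -- the generators are primitive idempotents; dimensions and weights
        (AbelianCode.IsPrimitiveIdempotent (AbelianCode.e₀ G) ∧
          AbelianCode.dim (AbelianCode.code (AbelianCode.e₀ G)) = 1 ∧
          AbelianCode.weight (AbelianCode.code (AbelianCode.e₀ G)) = p ^ 3) ∧
        (∀ j < p,
          AbelianCode.IsPrimitiveIdempotent (AbelianCode.e₁ p a b j) ∧
          AbelianCode.dim (AbelianCode.code (AbelianCode.e₁ p a b j)) = p ^ 2 - p ∧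
          AbelianCode.weight (AbelianCode.code (AbelianCode.e₁ p a b j)) = 2 * p) ∧
        (∀ i < p,
          AbelianCode.IsPrimitiveIdempotent (AbelianCode.e₂ a b i) ∧
          AbelianCode.dim (AbelianCode.code (AbelianCode.e₂ a b i)) = p - 1 ∧
          AbelianCode.weight (AbelianCode.code (AbelianCode.e₂ a b i)) = 2 * p ^ 2) ∧
        (AbelianCode.IsPrimitiveIdempotent (AbelianCode.e₃ p a b) ∧
          AbelianCode.dim (AbelianCode.code (AbelianCode.e₃ p a b)) = p - 1 ∧
          AbelianCode.weight (AbelianCode.code (AbelianCode.e₃ p a b)) = 2 * p ^ 2) ∧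
        -- the group violates Miller's assertion
        (Finite G ∧ Odd (Nat.card G) ∧ Monoid.exponent G = p ^ 2 ∧
          (p ^ 2).divisors.card = 3 ∧ ¬ AbelianCode.MillerClaim G)) ∧
    -- hence Miller's assertion is not true of all finite abelian groups
    ¬ ∀ (G : Type) [CommGroup G] [Finite G], AbelianCode.MillerClaim G := by
  refine ⟨?_, fun hM => AbelianCode.IsSqPrimeBasis.not_millerClaim
    (AbelianCode.isSqPrimeBasis_multiplicative_zmod_prod Nat.prime_three) (by decide)
    AbelianCode.exists_unit_zmod_nine_eq_two_zpowers_eq_top (hM _)⟩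
  intro p hp hodd h2 G _ a b ha hb hab
  have h : AbelianCode.IsSqPrimeBasis p a b := ⟨hp, ha, hb, hab⟩
  have primitive := h.isPrimitiveIdempotent_primIdem hodd h2
  exact ⟨⟨h.isMinimalCode_rep hodd h2, fun _ _ => h.not_gEquivalent_rep hodd,
      fun _ => h.exists_rep_gEquivalent hodd h2, h.numMinimalClasses_eq hodd h2⟩,
    ⟨fun _ => h.isMinimalCode_iff_listed hodd h2, h.ncard_isMinimalCode hodd h2⟩,
    ⟨primitive (.inl ()), h.dim_e₀ hodd, h.weight_e₀ hodd⟩,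
    fun j hj => ⟨primitive (.inr (.inr (.inl ⟨j, hj⟩))), h.dim_e₁ hodd j, h.weight_e₁ hodd j⟩,
    fun i hi => ⟨primitive (.inr (.inr (.inr ⟨i, hi⟩))), h.dim_e₂ hodd i, h.weight_e₂ hodd i⟩,
    ⟨primitive (.inr (.inl ())), h.dim_e₃ hodd, h.weight_e₃ hodd⟩,
    ⟨h.finite, h.odd_card hodd, h.exponent_eq, AbelianCode.card_divisors_prime_sq hp,
      h.not_millerClaim hodd h2⟩⟩
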